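/- Throughout, $\log=\log_2$, and strings are nonempty strings of length at most $M$, where $M\ge 1$ is fixed. **Automata.** A semiautomaton $D$ with finite state set $Q$ over an alphabet $\Pi$ has a transition function $\delta:Q\times\Pi\to Q$ and an initial state. An automaton over an alphabet $\Sigma$ has in addition an output function $Q\times\Sigma\to\Gamma$, and its value on $\sigma_1\cdots\sigma_n$ ($n\ge1$) is the output function applied to the state reached on $\sigma_1\cdots\sigma_{n-1}$ and to the letter $\sigma_n$. For a set $X$ and integers $m\le a$ let $\pi_m^a$ be the class of projections $\pi_J:X^a\to X^m$ with $J\subseteq\{1,\dots,a\}$, $|J|=m$. Given nonempty classes $\Phi$ of functions $X^m\to\Pi$, $\Delta$ (finite) of semiautomata over $\Pi$ with state set $Q$, and $\Theta$ of functions $Q\times X^m\to\Gamma$, with $\Pi,\Gamma$ finite, let $\mathcal A(\Phi,\Delta,\Theta;a,m,\Pi,\Gamma)$ be the class of automata over $X^a$ obtained by choosing $\pi_J\in\pi_m^a$, $\phi\in\Phi$, $D=(\delta,q_{\rm init})\in\Delta$, $\theta\in\Theta$, with transition function $(q,\sigma)\mapsto\delta(q,\phi(\pi_J(\sigma)))$,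 initial state $q_{\rm init}$, and output function $(q,\sigma)\mapsto\theta(q,\pi_J(\sigma))$. **Cascades.** Let $d\ge 1$, let $\Sigma_1$ be a nonempty, possibly infinite, alphabet, and let $\mathcal A_i=\mathcal A(\Phi_i,\Delta_i,\Theta_i;a_i,m_i,\Pi_i,\Gamma_i)$, $1\le i\le d$, be classes over $X_i^{a_i}$, where the input alphabet $\Sigma_1\times\Gamma_1\times\cdots\times\Gamma_{i-1}$ of component $i$ is read as $X_i^{a_i}$ through a fixed map $\Sigma_1\times\Gamma_1\times\cdots\times\Gamma_{i-1}\to X_i^{a_i}$ (for instance an identification). In a cascade of $A_1\in\mathcal A_1,\dots,A_d\in\mathcal A_d$, at each step component $i$ reads the external letter together with the current outputs of components $1,\dots,i-1$; the output of the cascade is that of $A_d$. Let $\mathcal C=\mathcal A_1\ltimes\cdots\ltimes\mathcal A_d$ be the (possibly infinite) class of functions from strings over $\Sigma_1$ to $\Gamma_d$ implemented by these cascades. **Growth and dimension.** For a class $\mathcal F$ of functions $X\to Y$ with $Y$ finite, the growth $G(\mathcal F,\ell)$ is the supremum over $x_1,\dots,x_\ell\in X$ of the number of distinct tuples $\langle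 f(x_1),\dots,f(x_\ell)\rangle$, $f\in\mathcal F$. If $|Y|=2$, $\dim(\mathcal F)$ is the VC dimension, i.e. the largest $h$ with $G(\mathcal F,h)=2^h$ (or $\infty$); otherwise $\dim(\mathcal F)$ is the graph dimension, i.e. the VC dimension of $\{(x,y)\mapsto\mathbf 1[f(x)=y] : f\in\mathcal F\}$. **Sample complexity.** Let the set $X$ carry a $\sigma$-algebra, and let $L:Y\times Y\to\{0,1\}$ be a loss. For a probability measure $P$ on $X$ and a measurable target $f_0:X\to Y$ the risk of $f$ is $R(f)=\mathbb E_{x\sim P}[L(f(x),f_0(x))]$. The sample complexity $S(\mathcal F,\varepsilon,\eta)$ is the least $\ell$ for which there is a rule mapping labelled samples $(x_i,f_0(x_i))_{i\le\ell}$ to functions $\hat f\in\mathcal F$ such that, for all $P$ and $f_0$, if $x_1,\dots,x_\ell$ are i.i.d. with law $P$ then $R(\hat f)-\inf_{f\in\mathcal F}R(f)\le\varepsilon$ except on an event of (outer) probability at most $\eta$. As usual in learning theory, measurability is assumed in (iii): every $f\in\mathcal C$ is measurable and, for all $\ell$, all $y\in\Gamma_d^\ell$ and all $P$, the set of samples $(x_1,\dots,x_\ell)$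 for which some $f\in\mathcal C$ satisfies $f(x_i)=y_i$ for all $i$ is $P^{\ell}$-measurable (up to null sets). **Theorem.** Write $$w=\log|\pi_m^a|+\log|\Delta|+\dim(\Phi)+\dim(\Theta),$$ where here and below a quantity without its index $i$ denotes its maximum over $i=1,\dots,d$ (so $|\pi_m^a|=\max_i|\pi_{m_i}^{a_i}|$, $\dim(\Phi)=\max_i\dim(\Phi_i)$, $|\Pi|=\max_i|\Pi_i|$, and so on). (i) For every $\ell$, $$G(\mathcal C,\ell)\le\prod_{i=1}^d|\pi_{m_i}^{a_i}|\cdot|\Delta_i|\cdot G(\Phi_i,\ell M)\cdot G(\Theta_i,\ell M).$$ (ii) If $\dim(\Phi),\dim(\Theta)<\infty$ and $w\ge2$, then $\dim(\mathcal C)$ is finite and $$\dim(\mathcal C)\le 2dw\,\log(d\,w\,e\,M\,|\Pi|\,|\Gamma|).$$ (iii) For all $\varepsilon,\eta>0$ there is a constant $K$, depending only on $\varepsilon$ and $\eta$, such that whenever $\dim(\Phi),\dim(\Theta)<\infty$ and $w\ge2$, for every $\sigma$-algebra on the set of strings that satisfies the measurability assumption and every loss $L$, the sample complexity of $\mathcal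 C$ is finite and $$S(\mathcal C,\varepsilon,\eta)\le K\,d\,w\,\log(d\,w\,M\,|\Pi|\,|\Gamma|).$$ -/

import Mathlib

open MeasureTheory

namespace AutomataCascade

universe u v w

/-! ### Growth and dimension of a class of functions -/

section Growth

variable {X : Type*} {Y : Type*}

/-- The set of patterns of the class `F` on the sequence `x` of length `ℓ`. -/
def patterns (F : Set (X → Y)) {ℓ : ℕ} (x : Fin ℓ → X) : Set (Fin ℓ → Y) :=
  (fun f i => f (x i)) '' F

/-- The growth `G(F, ℓ)`: the supremum, over all sequences of length `ℓ`, of the number of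
distinct patterns. -/
noncomputable def growth (F : Set (X → Y)) (ℓ : ℕ) : ℕ∞ :=
  ⨆ x : Fin ℓ → X, (patterns F x).encard

/-- The VC dimension of a (nonempty) class of two-valued functions: the largest `h` with
`G(F, h) = 2 ^ h`, and `⊤` if there are arbitrarily large such `h`. -/
noncomputable def vcDim (F : Set (X → Y)) : ℕ∞ :=
  ⨆ (h : ℕ) (_ : growth F h = 2 ^ h), (h : ℕ∞)

open Classical in
/-- The binarisation `(x, y) ↦ 𝟏[f x = y]` of a function. -/
noncomputable def binarise (f : X → Y) : X × Y → Bool :=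
  fun p => decide (f p.1 = p.2)

/-- The dimension of a class of functions: the VC dimension if the codomain has two elements,
and otherwise the graph dimension, i.e. the VC dimension of the binarised class. -/
noncomputable def dimension (F : Set (X → Y)) : ℕ∞ :=
  if Nat.card Y = 2 then vcDim F else vcDim (binarise '' F)

end Growth

/-! ### Sample complexity -/

section Learning

variable {X : Type*} {Y : Type*}

/-- The risk `𝔼[L(f(x), f₀(x))]` of `f`, for the target `f₀`, the `{0,1}`-valued loss `L` and
the distribution `P`. -/
noncomputable def risk [MeasurableSpace X] (L : Y → Y → Fin 2) (P : Measure X) (f₀ f : X → Y) :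
    ℝ :=
  ∫ x, ((L (f x) (f₀ x) : ℕ) : ℝ) ∂P

/-- A function to a finite set (with the discrete σ-algebra) is measurable. -/
def MeasurableLabels [MeasurableSpace X] (f : X → Y) : Prop :=
  ∀ y, MeasurableSet (f ⁻¹' {y})

/-- A sample size `ℓ` is sufficient for learning `F` with precision `ε` and confidence `1 - η`:
there is a learning rule mapping every labelled sample of size `ℓ` to an element of `F` such that,
for every distribution `P` and every target `f₀`, on an i.i.d. sample the returned function has
risk within `ε` of the infimum over `F`, except with (outer) probability at most `η`. -/
def SufficientSize [MeasurableSpace X] (F : Set (X → Y)) (L : Y → Y → Fin 2) (ε η : ℝ)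
    (ℓ : ℕ) : Prop :=
  ∃ rule : (Fin ℓ → X × Y) → F,
    ∀ (P : Measure X) [IsProbabilityMeasure P] (f₀ : X → Y), MeasurableLabels f₀ →
      Measure.pi (fun _ : Fin ℓ => P)
        {x | ε < risk L P f₀ (rule fun i => (x i, f₀ (x i))).1 - ⨅ f : F, risk L P f₀ f.1}
      ≤ ENNReal.ofReal η

/-- The sample complexity `S(F, ε, η)`: the minimum sufficient sample size
(`⊤` if no sample size is sufficient). -/
noncomputable def sampleComplexity [MeasurableSpace X] (F : Set (X → Y)) (L : Y → Y → Fin 2)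
    (ε η : ℝ) : ℕ∞ :=
  ⨅ (ℓ : ℕ) (_ : SufficientSize F L ε η ℓ), (ℓ : ℕ∞)

/-- Measurability convention for learning with a class `F`: every function in `F` is measurable
and, for every sequence of labels, the set of samples on which some function in `F` takes these
labels is measurable up to null sets, for every distribution. -/
def Permissible [MeasurableSpace X] (F : Set (X → Y)) : Prop :=
  (∀ f ∈ F, MeasurableLabels f) ∧
    ∀ (P : Measure X) [IsProbabilityMeasure P] (ℓ : ℕ) (y : Fin ℓ → Y),
      NullMeasurableSet {x : Fin ℓ → X | ∃ f ∈ F, ∀ i, f (x i) = y i}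
        (Measure.pi fun _ : Fin ℓ => P)

end Learning

/-! ### Automata -/

/-- A semiautomaton with input alphabet `A` and set of states `Q`. -/
structure Semiautomaton (A : Type*) (Q : Type*) where
  step : Q → A → Q
  init : Q

/-- The state reached from the initial state on an input string. -/
def Semiautomaton.run {A Q : Type*} (D : Semiautomaton A Q) (s : List A) : Q :=
  s.foldl D.step D.init

/-- An automaton: a semiautomaton together with an output function. -/
structure Automaton (A : Type*) (Q : Type*) (B : Type*) extends Semiautomaton A Q where
  out : Q → A → B

/-- The output on a nonempty string `σ₁ … σₙ`: the output function applied to the state reached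
on `σ₁ … σₙ₋₁` and to the letter `σₙ`. -/
def Automaton.eval {A Q B : Type*} (M : Automaton A Q B) (s : List A) (hs : s ≠ []) : B :=
  M.out (M.run s.dropLast) (s.getLast hs)

/-- The projection `π_J` of tuples to the coordinates in `J`, in increasing order. -/
def projection (X : Type*) {a m : ℕ} (J : Finset (Fin a)) (hJ : J.card = m) :
    (Fin a → X) → (Fin m → X) :=
  fun t k => t (J.orderEmbOfFin hJ k)

/-- The class `π_m^a` of all projections on sets of coordinates of cardinality `m`. -/
def projections (X : Type*) (a m : ℕ) : Set ((Fin a → X) → (Fin m → X)) :=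
  {p | ∃ (J : Finset (Fin a)) (hJ : J.card = m), p = projection X J hJ}

/-- An automaton on the factored alphabet `X ^ a`, with dependency set `dep` of cardinality `m`,
internal alphabet `N`, input function `inFun`, semiautomaton `semi` on the internal letters, and
output function `outFun`. -/
structure FactoredAutomaton (X : Type*) (a m : ℕ) (N : Type*) (Q : Type*) (B : Type*) where
  dep : Finset (Fin a)
  card_dep : dep.card = m
  inFun : (Fin m → X) → N
  semi : Semiautomaton N Q
  outFun : Q × (Fin m → X) → B

/-- The automaton over the alphabet `X ^ a` induced by a factored automaton. -/
def FactoredAutomaton.induced {X : Type*} {a m : ℕ} {N Q B : Type*}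
    (M : FactoredAutomaton X a m N Q B) : Automaton (Fin a → X) Q B where
  step q σ := M.semi.step q (M.inFun (projection X M.dep M.card_dep σ))
  init := M.semi.init
  out q σ := M.outFun (q, projection X M.dep M.card_dep σ)

/-- The class `𝒜(Φ, Δ, Θ; a, m)` of automata with input function from `Φ`, semiautomaton (on the
internal letters) from `Δ`, and output function from `Θ`. -/
def automataClass {X : Type*} (a : ℕ) {m : ℕ} {N Q B : Type*} (Φ : Set ((Fin m → X) → N))
    (Δ : Set (Semiautomaton N Q)) (Θ : Set (Q × (Fin m → X) → B)) :
    Set (FactoredAutomaton X a m N Q B) :=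
  {M | M.inFun ∈ Φ ∧ M.semi ∈ Δ ∧ M.outFun ∈ Θ}

/-- Reading letters of `A'` as letters of `A`. -/
def Automaton.reindex {A A' Q B : Type*} (e : A' → A) (M : Automaton A Q B) :
    Automaton A' Q B where
  step q σ := M.step q (e σ)
  init := M.init
  out q σ := M.out q (e σ)

/-! ### Cascades -/

section Cascade

variable {d : ℕ}

/-- The input alphabet of component `i` of a cascade: the external input letter, together with
the output letters of all the preceding components. -/
abbrev CascadeInput (S : Type*) (B : Fin d → Type*) (i : Fin d) : Type _ :=
  S × ((j : {j : Fin d // j < i}) → B j.1)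

variable {S : Type*} {Q B : Fin d → Type*}

/-- The output letter of component `i` when the components are in the states `q` and the external
input letter is `σ`. -/
def cascadeOut (A : (i : Fin d) → Automaton (CascadeInput S B i) (Q i) (B i))
    (q : (i : Fin d) → Q i) (σ : S) (i : Fin d) : B i :=
  (A i).out (q i) (σ, fun j => cascadeOut A q σ j.1)
termination_by i
decreasing_by exact j.2

/-- The input letter read by component `i`. -/
def cascadeIn (A : (i : Fin d) → Automaton (CascadeInput S B i) (Q i) (B i))
    (q : (i : Fin d) → Q i) (σ : S) (i : Fin d) : CascadeInput S B i :=
  (σ, fun j => cascadeOut A q σ j.1)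

/-- The automaton defined by a cascade; its output is the output of the component `last`. -/
def cascadeAutomaton (A : (i : Fin d) → Automaton (CascadeInput S B i) (Q i) (B i))
    (last : Fin d) : Automaton S ((i : Fin d) → Q i) (B last) where
  step q σ := fun i => (A i).step (q i) (cascadeIn A q σ i)
  init := fun i => (A i).init
  out q σ := (A last).out (q last) (cascadeIn A q σ last)

end Cascade

/-- Nonempty strings of length at most `M` over the alphabet `S`. -/
abbrev Str (S : Type*) (M : ℕ) : Type _ := {s : List S // s ≠ [] ∧ s.length ≤ M}

/-- The data of a class of cascades `𝒜₁ ⋉ ⋯ ⋉ 𝒜_d` with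
`𝒜ᵢ = 𝒜(Φᵢ, Δᵢ, Θᵢ; aᵢ, mᵢ, Nᵢ, Bᵢ)`. The input alphabet of component `i` (external letter and
preceding output letters) is presented as a factored alphabet `Xᵢ ^ aᵢ` through the map `enc i`. -/
structure CascadeClass where
  /-- number of components -/
  d : ℕ
  d_pos : 0 < d
  /-- external input alphabet -/
  S : Type u
  S_nonempty : Nonempty S
  /-- domains and arities of the factored alphabets -/
  X : Fin d → Type v
  a : Fin d → ℕ
  /-- degrees of dependency -/
  m : Fin d → ℕ
  m_le : ∀ i, m i ≤ a i
  /-- internal alphabets -/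
  N : Fin d → Type w
  N_finite : ∀ i, Finite (N i)
  /-- states -/
  Q : Fin d → Type w
  Q_finite : ∀ i, Finite (Q i)
  /-- output alphabets -/
  B : Fin d → Type w
  B_finite : ∀ i, Finite (B i)
  enc : (i : Fin d) → CascadeInput S B i → (Fin (a i) → X i)
  /-- input functions -/
  Φ : (i : Fin d) → Set ((Fin (m i) → X i) → N i)
  Φ_nonempty : ∀ i, (Φ i).Nonempty
  /-- semiautomata -/
  Δ : (i : Fin d) → Set (Semiautomaton (N i) (Q i))
  Δ_nonempty : ∀ i, (Δ i).Nonempty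
  Δ_finite : ∀ i, (Δ i).Finite
  /-- output functions -/
  Θ : (i : Fin d) → Set (Q i × (Fin (m i) → X i) → B i)
  Θ_nonempty : ∀ i, (Θ i).Nonempty

namespace CascadeClass

variable (𝒞 : CascadeClass.{u, v, w})

/-- The last component. -/
def last : Fin 𝒞.d := ⟨𝒞.d - 1, Nat.sub_lt 𝒞.d_pos Nat.one_pos⟩

/-- The class of functions implemented by the cascades of the class, on the nonempty strings of
length at most `M`. -/
def functions (M : ℕ) : Set (Str 𝒞.S M → 𝒞.B 𝒞.last) :=
  {f | ∃ A : (i : Fin 𝒞.d) →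
      FactoredAutomaton (𝒞.X i) (𝒞.a i) (𝒞.m i) (𝒞.N i) (𝒞.Q i) (𝒞.B i),
    (∀ i, A i ∈ automataClass (𝒞.a i) (𝒞.Φ i) (𝒞.Δ i) (𝒞.Θ i)) ∧
      f = fun s =>
        (cascadeAutomaton (fun i => (A i).induced.reindex (𝒞.enc i)) 𝒞.last).eval s.1 s.2.1}

/-- The maximum over the components of `dim(Φᵢ)`. -/
noncomputable def maxDimΦ : ℕ∞ := Finset.univ.sup fun i => dimension (𝒞.Φ i)

/-- The maximum over the components of `dim(Θᵢ)`. -/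
noncomputable def maxDimΘ : ℕ∞ := Finset.univ.sup fun i => dimension (𝒞.Θ i)

/-- The maximum over the components of the number of projections. -/
noncomputable def maxProj : ℕ :=
  Finset.univ.sup fun i => (projections (𝒞.X i) (𝒞.a i) (𝒞.m i)).ncard

/-- The maximum over the components of the number of semiautomata. -/
noncomputable def maxΔ : ℕ := Finset.univ.sup fun i => (𝒞.Δ i).ncard

/-- The maximum cardinality of an internal alphabet. -/
noncomputable def maxN : ℕ := Finset.univ.sup fun i => Nat.card (𝒞.N i)

/-- The maximum cardinality of an output alphabet. -/
noncomputable def maxB : ℕ := Finset.univ.sup fun i => Nat.card (𝒞.B i)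

/-- `w = log |π_m^a| + log |Δ| + dim(Φ) + dim(Θ)`, each term a maximum over the components
(meaningful when the two dimensions are finite). -/
noncomputable def weight : ℝ :=
  Real.logb 2 𝒞.maxProj + Real.logb 2 𝒞.maxΔ + 𝒞.maxDimΦ.toNat + 𝒞.maxDimΘ.toNat

end CascadeClass

end AutomataCascade

open MeasureTheory

namespace AutomataCascade

universe u v w

/-! ### Counting images of sets -/

theorem encard_image_le_of_determined {α β γ : Type*} {P : Set α} {f : α → β} {g : α → γ}
    (h : ∀ a ∈ P, ∀ b ∈ P, f a = f b → g a = g b) : (g '' P).encard ≤ (f '' P).encard := by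
  rcases P.eq_empty_or_nonempty with rfl | ⟨a₀, -⟩
  · simp
  have : Nonempty α := ⟨a₀⟩
  choose! s hs using fun c (hc : c ∈ g '' P) => hc
  refine Set.encard_le_encard_of_injOn (f := fun c => f (s c))
    (fun c hc => ⟨s c, (hs c hc).1, rfl⟩) fun c hc c' hc' hcc => ?_
  rw [← (hs c hc).2, ← (hs c' hc').2]
  exact h _ (hs c hc).1 _ (hs c' hc').1 hcc

theorem encard_image_prod_le {α β γ : Type*} {P : Set α} {f : α → β} {g : α → γ}
    {c : ℕ∞} (h : ∀ a ∈ P, (g '' {b ∈ P | f b = f a}).encard ≤ c) :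
    ((fun a => (f a, g a)) '' P).encard ≤ (f '' P).encard * c := by
  have key : ∀ T : Finset β, (T : Set β) ⊆ f '' P →
      ((fun a => (f a, g a)) '' {a ∈ P | f a ∈ T}).encard ≤ (T : Set β).encard * c := by
    classical
    intro T
    induction T using Finset.induction_on with
    | empty => intro _; simp
    | insert b T hb ih =>
      intro hT
      rw [Finset.coe_insert] at hT
      obtain ⟨a, ha, rfl⟩ := hT (Set.mem_insert _ _)
      rw [Finset.coe_insert, Set.encard_insert_of_notMem (by simpa using hb), add_mul, one_mul]
      have hsplit : (fun a => (f a, g a)) '' {b ∈ P | f b ∈ insert (f a) T} ⊆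
          (fun a => (f a, g a)) '' {b ∈ P | f b ∈ T} ∪
            (fun a => (f a, g a)) '' {b ∈ P | f b = f a} := by
        rintro _ ⟨b, ⟨hb, hb'⟩, rfl⟩
        rcases Finset.mem_insert.1 hb' with h' | h'
        · exact Or.inr ⟨b, ⟨hb, h'⟩, rfl⟩
        · exact Or.inl ⟨b, ⟨hb, h'⟩, rfl⟩
      refine (Set.encard_le_encard hsplit).trans ((Set.encard_union_le _ _).trans ?_)
      gcongr
      · exact ih fun x hx => hT (Set.mem_insert_of_mem _ hx)
      · refine le_trans (encard_image_le_of_determined ?_) (h a ha)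
        rintro b ⟨_, hb⟩ b' ⟨_, hb'⟩ hbb
        simp only [Prod.mk.injEq]
        exact ⟨hb.trans hb'.symm, hbb⟩
  rcases P.eq_empty_or_nonempty with rfl | ⟨a₀, ha₀⟩
  · simp
  by_cases hfin : (f '' P).Finite
  swap
  · have hc : c ≠ 0 := by
      refine (zero_lt_one.trans_le (le_trans ?_ (h a₀ ha₀))).ne'
      exact Set.one_le_encard_iff_nonempty.2 ⟨g a₀, a₀, ⟨ha₀, rfl⟩, rfl⟩
    rw [Set.Infinite.encard_eq hfin, ENat.top_mul hc]
    exact le_top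
  have := key hfin.toFinset (by simp)
  rw [Set.Finite.coe_toFinset] at this
  refine le_trans (Set.encard_le_encard ?_) this
  rintro _ ⟨a, ha, rfl⟩
  exact ⟨a, ⟨ha, by simpa using ⟨a, ha, rfl⟩⟩, rfl⟩

/-! ### Growth and dimension -/

section

variable {X Y : Type*}

theorem encard_image_eval_le_growth {ι : Type*} [Finite ι] (F : Set (X → Y)) (z : ι → X) {n : ℕ}
    (hn : Nat.card ι = n) : ((fun f i => f (z i)) '' F).encard ≤ growth F n := by
  let e : ι ≃ Fin n := Finite.equivFinOfCardEq hn
  refine le_trans (encard_image_le_of_determined ?_)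
    (le_iSup (fun x : Fin n → X => (patterns F x).encard) (z ∘ e.symm))
  intro f _ g _ h
  funext i
  simpa using congrFun h (e i)

theorem growth_le_card_pow [Finite Y] (F : Set (X → Y)) (n : ℕ) :
    growth F n ≤ (Nat.card Y : ℕ∞) ^ n := by
  refine iSup_le fun x => (Set.encard_le_encard (Set.subset_univ _)).trans ?_
  rw [Set.encard_univ, ENat.card_eq_coe_natCard]
  simp [Nat.card_fun]

theorem growth_binarise_le (F : Set (X → Y)) (n : ℕ) : growth (binarise '' F) n ≤ growth F n := by
  refine iSup_le fun x => ?_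
  refine le_trans ?_ (le_iSup (fun x : Fin n → X => (patterns F x).encard) fun i => (x i).1)
  rw [patterns, Set.image_image]
  refine encard_image_le_of_determined fun f _ g _ h => ?_
  funext i
  have := congrFun h i
  simp only at this
  simp [binarise, this]

theorem growth_le_growth_binarise [Finite Y] (F : Set (X → Y)) (n : ℕ) :
    growth F n ≤ growth (binarise '' F) (n * Nat.card Y) := by
  refine iSup_le fun x => ?_
  refine le_trans ?_ (encard_image_eval_le_growth (binarise '' F)
    (fun p : Fin n × Y => (x p.1, p.2)) (by simp [Nat.card_prod]))
  rw [patterns, Set.image_image]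
  refine encard_image_le_of_determined fun f _ g _ h => ?_
  funext i
  have := congrFun h (i, f (x i))
  simpa [binarise, eq_comm] using this

theorem le_vcDim {F : Set (X → Y)} {n : ℕ} (h : growth F n = 2 ^ n) : (n : ℕ∞) ≤ vcDim F :=
  le_iSup₂ (f := fun (h : ℕ) (_ : growth F h = 2 ^ h) => (h : ℕ∞)) n h

theorem vcDim_binarise_le_dimension (F : Set (X → Y)) : vcDim (binarise '' F) ≤ dimension F := by
  unfold dimension
  split_ifs with hY
  · have : Finite Y := Nat.finite_of_card_ne_zero (by omega)
    refine iSup₂_le fun n hn => le_vcDim (le_antisymm ?_ ?_)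
    · simpa [hY] using growth_le_card_pow F n
    · exact hn ▸ growth_binarise_le F n
  · exact le_rfl

theorem dimension_le_of_growth {F : Set (X → Y)} {N : ℕ}
    (h : ∀ n : ℕ, 2 ^ n ≤ growth F n → n ≤ N) : dimension F ≤ N := by
  unfold dimension
  split_ifs with hY
  · exact iSup₂_le fun n hn => Nat.cast_le.2 (h n hn.ge)
  · exact iSup₂_le fun n hn => Nat.cast_le.2 (h n (hn ▸ growth_binarise_le F n))

theorem sum_choose_le_one_add_pow (h L : ℕ) : ∑ k ∈ Finset.Iic h, L.choose k ≤ (1 + L) ^ h := by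
  rw [add_comm, add_pow, ← Nat.range_succ_eq_Iic]
  refine Finset.sum_le_sum fun k hk => ?_
  have hk : k ≤ h := by simpa [Nat.lt_succ_iff] using hk
  calc L.choose k ≤ L ^ k := Nat.choose_le_pow L k
    _ = L ^ k * 1 * 1 := by ring
    _ ≤ _ := by
      rw [one_pow]
      exact Nat.mul_le_mul_left _ (Nat.choose_pos hk)

/-- The Sauer–Shelah lemma for classes of two-valued functions. -/
theorem growth_le_of_vcDim_le {F : Set (X → Bool)} {h : ℕ} (hF : vcDim F ≤ h) (L : ℕ) :
    growth F L ≤ ((1 + L) ^ h : ℕ) := by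
  classical
  refine iSup_le fun x => ?_
  let φ : (Fin L → Bool) → Finset (Fin L) := fun p => Finset.univ.filter fun i => p i = true
  have hφ : Function.Injective φ := fun p q hpq => by
    funext i
    have := Finset.ext_iff.1 hpq i
    simp only [φ, Finset.mem_filter, Finset.mem_univ, true_and] at this
    exact Bool.eq_iff_iff.2 this
  let 𝒜 : Finset (Finset (Fin L)) := (Set.toFinite (φ '' patterns F x)).toFinset
  have hcard : (patterns F x).encard = 𝒜.card := by
    rw [← hφ.injOn.encard_image, (Set.toFinite _).encard_eq_coe_toFinset_card]
  have hdim : 𝒜.vcDim ≤ h := by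
    refine Finset.sup_le fun s hs => ?_
    rw [Finset.mem_shatterer] at hs
    have hgr : growth F s.card = 2 ^ s.card := by
      refine le_antisymm (by simpa using growth_le_card_pow F s.card) ?_
      refine le_trans (le_of_eq ?_) (encard_image_eval_le_growth F (fun i : s => x i) (by simp))
      have : (fun (f : X → Bool) (i : s) => f (x i)) '' F = Set.univ := by
        refine Set.eq_univ_of_forall fun p => ?_
        obtain ⟨u, hu, hsu⟩ := hs (t := (Finset.univ.filter fun i : s => p i = true).map
          (Function.Embedding.subtype _)) (by intro i; simp +contextual)
        simp only [𝒜, Set.Finite.mem_toFinset, patterns, Set.mem_image] at hu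
        obtain ⟨_, ⟨f, hf, rfl⟩, rfl⟩ := hu
        refine ⟨f, hf, funext fun i => ?_⟩
        have := Finset.ext_iff.1 hsu i.1
        simp only [φ, Finset.mem_inter, i.2, true_and, Finset.mem_filter, Finset.mem_univ,
          Finset.mem_map, Function.Embedding.subtype_apply, Subtype.coe_inj, exists_eq_right]
          at this
        exact Bool.eq_iff_iff.2 this
      rw [this, Set.encard_univ, ENat.card_eq_coe_natCard]
      simp
    exact_mod_cast (le_vcDim hgr).trans hF
  rw [hcard]
  refine Nat.cast_le.2 ((𝒜.card_le_card_shatterer.trans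
    𝒜.card_shatterer_le_sum_vcDim).trans ?_)
  rw [Fintype.card_fin]
  exact (Finset.sum_le_sum_of_subset (Finset.Iic_subset_Iic.2 hdim)).trans
    (sum_choose_le_one_add_pow h L)

theorem growth_le_of_dimension_le [Finite Y] {F : Set (X → Y)} {h : ℕ} (hF : dimension F ≤ h)
    (L : ℕ) : growth F L ≤ ((1 + L * Nat.card Y) ^ h : ℕ) :=
  (growth_le_growth_binarise F L).trans
    (growth_le_of_vcDim_le ((vcDim_binarise_le_dimension F).trans hF) _)

end

namespace CascadeClass

/-! ### The growth of a class of cascades -/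

variable (𝒞 : CascadeClass.{u, v, w})

/-- A choice of a factored automaton for every component. -/
abbrev Choice : Type _ := (i : Fin 𝒞.d) →
  FactoredAutomaton (𝒞.X i) (𝒞.a i) (𝒞.m i) (𝒞.N i) (𝒞.Q i) (𝒞.B i)

/-- The choices that belong to the component classes. -/
def choices : Set 𝒞.Choice :=
  {A | ∀ i, A i ∈ automataClass (𝒞.a i) (𝒞.Φ i) (𝒞.Δ i) (𝒞.Θ i)}

variable {𝒞}

/-- The component automata over the cascade alphabets. -/
def Choice.aut (A : 𝒞.Choice) (i : Fin 𝒞.d) :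
    Automaton (CascadeInput 𝒞.S 𝒞.B i) (𝒞.Q i) (𝒞.B i) :=
  (A i).induced.reindex (𝒞.enc i)

/-- The projection used by component `i`. -/
def Choice.proj (A : 𝒞.Choice) (i : Fin 𝒞.d) : (Fin (𝒞.a i) → 𝒞.X i) → (Fin (𝒞.m i) → 𝒞.X i) :=
  projection (𝒞.X i) (A i).dep (A i).card_dep

/-- The states of the components before the letter number `t` of a sequence of letters. -/
def Choice.trace (A : 𝒞.Choice) (σ : ℕ → 𝒞.S) : ℕ → (i : Fin 𝒞.d) → 𝒞.Q i
  | 0 => fun i => (A i).semi.init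
  | t + 1 => (cascadeAutomaton A.aut 𝒞.last).step (A.trace σ t) (σ t)

/-- The outputs of the components on the letter number `t` of a sequence of letters. -/
def Choice.output (A : 𝒞.Choice) (σ : ℕ → 𝒞.S) (t : ℕ) (i : Fin 𝒞.d) : 𝒞.B i :=
  cascadeOut A.aut (A.trace σ t) (σ t) i

/-- The letter number `t` as read by component `i`, before the projection. -/
def Choice.input (A : 𝒞.Choice) (σ : ℕ → 𝒞.S) (t : ℕ) (i : Fin 𝒞.d) : Fin (𝒞.a i) → 𝒞.X i :=
  𝒞.enc i (σ t, fun j => A.output σ t j.1)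

theorem Choice.output_eq (A : 𝒞.Choice) (σ : ℕ → 𝒞.S) (t : ℕ) (i : Fin 𝒞.d) :
    A.output σ t i = (A i).outFun (A.trace σ t i, A.proj i (A.input σ t i)) := by
  rw [Choice.output, cascadeOut]
  rfl

theorem Choice.trace_succ (A : 𝒞.Choice) (σ : ℕ → 𝒞.S) (t : ℕ) (i : Fin 𝒞.d) :
    A.trace σ (t + 1) i =
      (A i).semi.step (A.trace σ t i) ((A i).inFun (A.proj i (A.input σ t i))) :=
  rfl

theorem Choice.trace_eq_run (A : 𝒞.Choice) (s : List 𝒞.S) (σ : ℕ → 𝒞.S)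
    (hσ : ∀ (t : ℕ) (ht : t < s.length), σ t = s[t]) (t : ℕ) (ht : t ≤ s.length) :
    A.trace σ t = (cascadeAutomaton A.aut 𝒞.last).run (s.take t) := by
  induction t with
  | zero => rfl
  | succ t ih =>
    rw [List.take_succ_eq_append_getElem ht, Semiautomaton.run, List.foldl_append, Choice.trace,
      ih (by omega), hσ t ht]
    rfl

theorem Choice.eval_eq_output (A : 𝒞.Choice) (s : List 𝒞.S) (hs : s ≠ []) (σ : ℕ → 𝒞.S)
    (hσ : ∀ (t : ℕ) (ht : t < s.length), σ t = s[t]) :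
    (cascadeAutomaton A.aut 𝒞.last).eval s hs = A.output σ (s.length - 1) 𝒞.last := by
  have hlen : s.length - 1 < s.length := Nat.sub_lt (List.length_pos_of_ne_nil hs) one_pos
  rw [Choice.output, cascadeOut, Automaton.eval, List.dropLast_eq_take, List.getLast_eq_getElem,
    ← A.trace_eq_run s σ hσ _ hlen.le, ← hσ _ hlen]
  rfl

/-- The outputs of the components before the component number `k`, on the first `M` letters of a
family of sequences of letters. -/
def observe {ℓ : ℕ} (x : Fin ℓ → ℕ → 𝒞.S) (M k : ℕ) (A : 𝒞.Choice)
    (i : {i : Fin 𝒞.d // i.1 < k}) (p : Fin ℓ × Fin M) : 𝒞.B i.1 :=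
  A.output (x p.1) p.2 i.1

theorem encard_observe_succ_le {ℓ : ℕ} (x : Fin ℓ → ℕ → 𝒞.S) (M k : ℕ) (hk : k < 𝒞.d) :
    (observe x M (k + 1) '' 𝒞.choices).encard ≤
      (observe x M k '' 𝒞.choices).encard *
        ((projections (𝒞.X ⟨k, hk⟩) (𝒞.a ⟨k, hk⟩) (𝒞.m ⟨k, hk⟩)).encard *
          (𝒞.Δ ⟨k, hk⟩).encard * growth (𝒞.Φ ⟨k, hk⟩) (ℓ * M) *
            growth (𝒞.Θ ⟨k, hk⟩) (ℓ * M)) := by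
  set i : Fin 𝒞.d := ⟨k, hk⟩ with hi
  let f₁ : 𝒞.Choice → _ := fun A => (observe x M k A, A.proj i)
  let f₂ : 𝒞.Choice → _ := fun A => (f₁ A, (A i).semi)
  let inPat : 𝒞.Choice → Fin ℓ × Fin M → 𝒞.N i := fun A p =>
    (A i).inFun (A.proj i (A.input (x p.1) p.2 i))
  let f₃ : 𝒞.Choice → _ := fun A => (f₂ A, inPat A)
  let outPat : 𝒞.Choice → Fin ℓ × Fin M → 𝒞.B i := fun A p =>
    (A i).outFun (A.trace (x p.1) p.2 i, A.proj i (A.input (x p.1) p.2 i))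
  let f₄ : 𝒞.Choice → _ := fun A => (f₃ A, outPat A)
  have hinput : ∀ A A' : 𝒞.Choice, f₁ A = f₁ A' → ∀ p : Fin ℓ × Fin M,
      A.proj i (A.input (x p.1) p.2 i) = A'.proj i (A'.input (x p.1) p.2 i) := by
    intro A A' h p
    have h1 := congrArg Prod.fst h
    have h2 : A.proj i = A'.proj i := congrArg Prod.snd h
    rw [h2, Choice.input, Choice.input]
    congr 3
    funext j
    exact congrFun (congrFun h1 ⟨j.1, j.2⟩) p
  have htrace : ∀ A A' : 𝒞.Choice, f₃ A = f₃ A' → ∀ (j : Fin ℓ) (t : ℕ), t < M →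
      A.trace (x j) t i = A'.trace (x j) t i := by
    intro A A' h j t
    have h1 : (A i).semi = (A' i).semi := congrArg (fun y => y.1.2) h
    induction t with
    | zero => intro _; simp [Choice.trace, h1]
    | succ t ih =>
      intro ht
      have h2 : inPat A (j, ⟨t, by omega⟩) = inPat A' (j, ⟨t, by omega⟩) :=
        congrFun (congrArg Prod.snd h) _
      simp only [inPat] at h2
      rw [Choice.trace_succ, Choice.trace_succ, ih (by omega), h1, h2]
  have hcard : Nat.card (Fin ℓ × Fin M) = ℓ * M := by simp
  have e₁ : (f₁ '' 𝒞.choices).encard ≤ (observe x M k '' 𝒞.choices).encard *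
      (projections (𝒞.X i) (𝒞.a i) (𝒞.m i)).encard := by
    refine encard_image_prod_le fun A hA => Set.encard_le_encard ?_
    rintro _ ⟨A', -, rfl⟩
    exact ⟨_, _, rfl⟩
  have e₂ : (f₂ '' 𝒞.choices).encard ≤ (f₁ '' 𝒞.choices).encard * (𝒞.Δ i).encard := by
    refine encard_image_prod_le fun A hA => Set.encard_le_encard ?_
    rintro _ ⟨A', ⟨hA', -⟩, rfl⟩
    exact (hA' i).2.1
  have e₃ : (f₃ '' 𝒞.choices).encard ≤ (f₂ '' 𝒞.choices).encard * growth (𝒞.Φ i) (ℓ * M) := by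
    refine encard_image_prod_le fun A hA => le_trans (Set.encard_le_encard ?_)
      (encard_image_eval_le_growth (𝒞.Φ i)
        (fun p : Fin ℓ × Fin M => A.proj i (A.input (x p.1) p.2 i)) hcard)
    rintro _ ⟨A', ⟨hA', h⟩, rfl⟩
    refine ⟨(A' i).inFun, (hA' i).1, funext fun p => ?_⟩
    simp only [inPat, hinput A' A (congrArg Prod.fst h) p]
  have e₄ : (f₄ '' 𝒞.choices).encard ≤ (f₃ '' 𝒞.choices).encard * growth (𝒞.Θ i) (ℓ * M) := by
    refine encard_image_prod_le fun A hA => le_trans (Set.encard_le_encard ?_)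
      (encard_image_eval_le_growth (𝒞.Θ i) (fun p : Fin ℓ × Fin M =>
        (A.trace (x p.1) p.2 i, A.proj i (A.input (x p.1) p.2 i))) hcard)
    rintro _ ⟨A', ⟨hA', h⟩, rfl⟩
    refine ⟨(A' i).outFun, (hA' i).2.2, funext fun p => ?_⟩
    simp only [outPat, hinput A' A (congrArg (fun y => y.1.1) h) p, htrace A' A h p.1 p.2 p.2.2]
  have e₅ : (observe x M (k + 1) '' 𝒞.choices).encard ≤ (f₄ '' 𝒞.choices).encard := by
    refine encard_image_le_of_determined fun A _ A' _ h => ?_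
    funext j p
    rcases Nat.lt_succ_iff_lt_or_eq.1 j.2 with hj | hj
    · exact congrFun (congrFun (congrArg (fun y => y.1.1.1.1) h) ⟨j.1, hj⟩) p
    · obtain ⟨j, hj'⟩ := j
      obtain rfl : j = i := Fin.ext hj
      have := congrFun (congrArg Prod.snd h) p
      simp only [f₄, outPat] at this
      rw [observe, observe, Choice.output_eq, Choice.output_eq, this]
  refine e₅.trans (e₄.trans ?_)
  rw [← mul_assoc, ← mul_assoc, ← mul_assoc]
  gcongr
  exact e₃.trans (mul_le_mul_left (e₂.trans (mul_le_mul_left e₁ _)) _)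

variable (𝒞) in
/-- The contribution of component `i` to the growth of the class of cascades. -/
noncomputable def growthFactor (n : ℕ) (i : Fin 𝒞.d) : ℕ∞ :=
  (projections (𝒞.X i) (𝒞.a i) (𝒞.m i)).encard * (𝒞.Δ i).encard *
    growth (𝒞.Φ i) n * growth (𝒞.Θ i) n

theorem encard_observe_le {ℓ : ℕ} (x : Fin ℓ → ℕ → 𝒞.S) (M k : ℕ) (hk : k ≤ 𝒞.d) :
    (observe x M k '' 𝒞.choices).encard ≤
      ∏ i : Fin 𝒞.d with i.1 < k, 𝒞.growthFactor (ℓ * M) i := by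
  induction k with
  | zero =>
    simp only [Nat.not_lt_zero, Finset.filter_false, Finset.prod_empty]
    refine Set.encard_le_one_iff.2 fun a b _ _ => funext fun i => absurd i.2 (Nat.not_lt_zero _)
  | succ k ih =>
    have hfilter : (Finset.univ.filter fun i : Fin 𝒞.d => i.1 < k + 1) =
        insert ⟨k, hk⟩ (Finset.univ.filter fun i : Fin 𝒞.d => i.1 < k) := by
      ext i
      simp [Fin.ext_iff]
      omega
    rw [hfilter, Finset.prod_insert (by simp), mul_comm]
    exact (encard_observe_succ_le x M k hk).trans (mul_le_mul_left (ih (by omega)) _)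

theorem growth_functions_le (M ℓ : ℕ) :
    growth (𝒞.functions M) ℓ ≤ ∏ i : Fin 𝒞.d, 𝒞.growthFactor (ℓ * M) i := by
  refine iSup_le fun s => ?_
  obtain ⟨σ₀⟩ := 𝒞.S_nonempty
  let x : Fin ℓ → ℕ → 𝒞.S := fun j t => (s j).1.getD t σ₀
  have hobs := encard_observe_le x M 𝒞.d le_rfl
  rw [Finset.filter_true_of_mem fun i _ => i.2] at hobs
  refine le_trans ?_ hobs
  let ev : 𝒞.Choice → Fin ℓ → 𝒞.B 𝒞.last := fun A j =>
    (cascadeAutomaton A.aut 𝒞.last).eval (s j).1 (s j).2.1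
  have hpat : patterns (𝒞.functions M) s = ev '' 𝒞.choices := by
    ext p
    constructor
    · rintro ⟨_, ⟨A, hA, rfl⟩, rfl⟩
      exact ⟨A, hA, rfl⟩
    · rintro ⟨A, hA, rfl⟩
      exact ⟨_, ⟨A, hA, rfl⟩, rfl⟩
  rw [hpat]
  refine encard_image_le_of_determined fun A _ A' _ h => ?_
  funext j
  have hx : ∀ (t : ℕ) (ht : t < (s j).1.length), x j t = (s j).1[t] := fun t ht =>
    List.getD_eq_getElem _ _ ht
  have hpos := List.length_pos_of_ne_nil (s j).2.1
  simp only [ev, Choice.eval_eq_output _ _ (s j).2.1 (x j) hx]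
  exact congrFun (congrFun h ⟨𝒞.last, 𝒞.last.2⟩)
    (j, ⟨(s j).1.length - 1, lt_of_lt_of_le (Nat.sub_lt hpos one_pos) (s j).2.2⟩)

end CascadeClass

theorem finite_projections (X : Type*) (a m : ℕ) : (projections X a m).Finite := by
  refine (Set.finite_range fun J : {J : Finset (Fin a) // J.card = m} =>
    projection X J.1 J.2).subset ?_
  rintro _ ⟨J, hJ, rfl⟩
  exact ⟨⟨J, hJ⟩, rfl⟩

theorem projections_nonempty (X : Type*) {a m : ℕ} (h : m ≤ a) : (projections X a m).Nonempty := by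
  obtain ⟨J, -, hJ⟩ := Finset.exists_subset_card_eq (s := (Finset.univ : Finset (Fin a))) (n := m)
    (by simpa using h)
  exact ⟨_, J, hJ, rfl⟩

namespace CascadeClass

variable (𝒞 : CascadeClass.{u, v, w})

theorem nonempty_letters (i : Fin 𝒞.d) : Nonempty (Fin (𝒞.m i) → 𝒞.X i) ∧ Nonempty (𝒞.B i) := by
  induction i using WellFoundedLT.induction with
  | ind i ih =>
    obtain ⟨σ⟩ := 𝒞.S_nonempty
    obtain ⟨_, J, hJ, rfl⟩ := projections_nonempty (𝒞.X i) (𝒞.m_le i)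
    obtain ⟨D, -⟩ := 𝒞.Δ_nonempty i
    obtain ⟨θ, -⟩ := 𝒞.Θ_nonempty i
    have t := projection (𝒞.X i) J hJ
      (𝒞.enc i (σ, fun j => Classical.choice (ih j.1 j.2).2))
    exact ⟨⟨t⟩, ⟨θ (D.init, t)⟩⟩

theorem nonempty_N (i : Fin 𝒞.d) : Nonempty (𝒞.N i) := by
  obtain ⟨t⟩ := (𝒞.nonempty_letters i).1
  obtain ⟨φ, -⟩ := 𝒞.Φ_nonempty i
  exact ⟨φ t⟩

theorem choices_nonempty : 𝒞.choices.Nonempty := by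
  choose φ hφ using 𝒞.Φ_nonempty
  choose D hD using 𝒞.Δ_nonempty
  choose θ hθ using 𝒞.Θ_nonempty
  choose J hJ using fun i => (Finset.exists_subset_card_eq
    (s := (Finset.univ : Finset (Fin (𝒞.a i)))) (n := 𝒞.m i) (by simpa using 𝒞.m_le i))
  exact ⟨fun i => ⟨J i, (hJ i).2, φ i, D i, θ i⟩, fun i => ⟨hφ i, hD i, hθ i⟩⟩

theorem functions_nonempty (M : ℕ) : (𝒞.functions M).Nonempty := by
  obtain ⟨A, hA⟩ := 𝒞.choices_nonempty
  exact ⟨_, A, hA, rfl⟩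

theorem one_le_maxN : 1 ≤ 𝒞.maxN := by
  have := 𝒞.N_finite 𝒞.last
  have := 𝒞.nonempty_N 𝒞.last
  exact Nat.card_pos.trans_le
    (Finset.le_sup (f := fun i => Nat.card (𝒞.N i)) (Finset.mem_univ 𝒞.last))

theorem one_le_maxB : 1 ≤ 𝒞.maxB := by
  have := 𝒞.B_finite 𝒞.last
  have := (𝒞.nonempty_letters 𝒞.last).2
  exact Nat.card_pos.trans_le
    (Finset.le_sup (f := fun i => Nat.card (𝒞.B i)) (Finset.mem_univ 𝒞.last))

/-- The product `M |Π| |Γ|`. -/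
noncomputable def size (M : ℕ) : ℝ := M * 𝒞.maxN * 𝒞.maxB

theorem one_le_size {M : ℕ} (hM : 1 ≤ M) : 1 ≤ 𝒞.size M := by
  have : 1 ≤ M * 𝒞.maxN * 𝒞.maxB :=
    Nat.mul_pos (Nat.mul_pos hM 𝒞.one_le_maxN) 𝒞.one_le_maxB
  unfold size
  exact_mod_cast this

theorem exists_growthFactor_le {M : ℕ} (hM : 1 ≤ M) (hΦ : 𝒞.maxDimΦ ≠ ⊤) (hΘ : 𝒞.maxDimΘ ≠ ⊤)
    {ℓ : ℕ} (hℓ : 1 ≤ ℓ) (i : Fin 𝒞.d) :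
    ∃ g : ℕ, 𝒞.growthFactor (ℓ * M) i ≤ g ∧ (g : ℝ) ≤ (2 * ℓ * 𝒞.size M) ^ 𝒞.weight := by
  have hN := 𝒞.N_finite i
  have hB := 𝒞.B_finite i
  have hi := Finset.mem_univ i
  have hdΦ : dimension (𝒞.Φ i) ≤ (𝒞.maxDimΦ.toNat : ℕ∞) := by
    rw [ENat.natCast_toNat hΦ]
    exact Finset.le_sup (f := fun i => dimension (𝒞.Φ i)) hi
  have hdΘ : dimension (𝒞.Θ i) ≤ (𝒞.maxDimΘ.toNat : ℕ∞) := by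
    rw [ENat.natCast_toNat hΘ]
    exact Finset.le_sup (f := fun i => dimension (𝒞.Θ i)) hi
  have hp : (projections (𝒞.X i) (𝒞.a i) (𝒞.m i)).ncard ≤ 𝒞.maxProj :=
    Finset.le_sup (f := fun i => (projections (𝒞.X i) (𝒞.a i) (𝒞.m i)).ncard) hi
  have hΔ : (𝒞.Δ i).ncard ≤ 𝒞.maxΔ := Finset.le_sup (f := fun i => (𝒞.Δ i).ncard) hi
  have hN' : Nat.card (𝒞.N i) ≤ 𝒞.maxN := Finset.le_sup (f := fun i => Nat.card (𝒞.N i)) hi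
  have hB' : Nat.card (𝒞.B i) ≤ 𝒞.maxB := Finset.le_sup (f := fun i => Nat.card (𝒞.B i)) hi
  have hp1 : 1 ≤ 𝒞.maxProj := ((Set.ncard_pos (finite_projections _ _ _)).2
    (projections_nonempty _ (𝒞.m_le i))).trans_le hp
  have hΔ1 : 1 ≤ 𝒞.maxΔ := ((Set.ncard_pos (𝒞.Δ_finite i)).2 (𝒞.Δ_nonempty i)).trans_le hΔ
  have hN1 := 𝒞.one_le_maxN
  have hB1 := 𝒞.one_le_maxB
  refine ⟨𝒞.maxProj * 𝒞.maxΔ * (1 + ℓ * M * Nat.card (𝒞.N i)) ^ 𝒞.maxDimΦ.toNat *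
    (1 + ℓ * M * Nat.card (𝒞.B i)) ^ 𝒞.maxDimΘ.toNat, ?_, ?_⟩
  · rw [growthFactor, Nat.cast_mul, Nat.cast_mul, Nat.cast_mul]
    refine mul_le_mul' (mul_le_mul' (mul_le_mul' ?_ ?_) (growth_le_of_dimension_le hdΦ _))
      (growth_le_of_dimension_le hdΘ _)
    · rw [← (finite_projections _ _ _).cast_ncard_eq]
      exact_mod_cast hp
    · rw [← (𝒞.Δ_finite i).cast_ncard_eq]
      exact_mod_cast hΔ
  · have hz2 : (2 : ℝ) ≤ 2 * ℓ * 𝒞.size M := by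
      have h1 : (1 : ℝ) ≤ ℓ := by exact_mod_cast hℓ
      have := one_le_mul_of_one_le_of_one_le h1 (𝒞.one_le_size hM)
      linarith
    set z : ℝ := 2 * ℓ * 𝒞.size M with hz
    have hz0 : 0 < z := by linarith
    have hlog : ∀ n : ℕ, 1 ≤ n → (n : ℝ) ≤ z ^ Real.logb 2 n := by
      intro n hn
      have hn' : (1 : ℝ) ≤ n := by exact_mod_cast hn
      calc (n : ℝ) = 2 ^ Real.logb 2 n :=
            (Real.rpow_logb two_pos (by norm_num) (by linarith)).symm
        _ ≤ z ^ Real.logb 2 n := Real.rpow_le_rpow zero_le_two hz2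
            (Real.logb_nonneg one_lt_two hn')
    have hpow : ∀ c h : ℕ, ℓ * M * c ≤ ℓ * (M * 𝒞.maxN * 𝒞.maxB) →
        (((1 + ℓ * M * c) ^ h : ℕ) : ℝ) ≤ z ^ (h : ℝ) := by
      intro c h hc
      rw [Real.rpow_natCast, Nat.cast_pow]
      refine pow_le_pow_left₀ (Nat.cast_nonneg _) ?_ h
      have h1 : 1 ≤ ℓ * (M * 𝒞.maxN * 𝒞.maxB) :=
        Nat.mul_pos hℓ (Nat.mul_pos (Nat.mul_pos hM hN1) hB1)
      have h2 : 1 + ℓ * M * c ≤ 2 * (ℓ * (M * 𝒞.maxN * 𝒞.maxB)) := by omega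
      calc ((1 + ℓ * M * c : ℕ) : ℝ) ≤ ((2 * (ℓ * (M * 𝒞.maxN * 𝒞.maxB)) : ℕ) : ℝ) := by
            exact_mod_cast h2
        _ = z := by rw [hz, size]; push_cast; ring
    have hbΦ := hpow (Nat.card (𝒞.N i)) 𝒞.maxDimΦ.toNat (by
      rw [mul_assoc]
      exact Nat.mul_le_mul_left _ ((Nat.mul_le_mul_left _ hN').trans (Nat.le_mul_of_pos_right _ hB1)))
    have hbΘ := hpow (Nat.card (𝒞.B i)) 𝒞.maxDimΘ.toNat (by
      rw [mul_assoc]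
      exact Nat.mul_le_mul_left _ (Nat.mul_le_mul (Nat.le_mul_of_pos_right _ hN1) hB'))
    rw [Nat.cast_mul, Nat.cast_mul, Nat.cast_mul, weight, Real.rpow_add hz0, Real.rpow_add hz0,
      Real.rpow_add hz0]
    gcongr
    · exact hlog _ hp1
    · exact hlog _ hΔ1

theorem exists_growth_functions_le {M : ℕ} (hM : 1 ≤ M) (hΦ : 𝒞.maxDimΦ ≠ ⊤)
    (hΘ : 𝒞.maxDimΘ ≠ ⊤) {ℓ : ℕ} (hℓ : 1 ≤ ℓ) :
    ∃ g : ℕ, growth (𝒞.functions M) ℓ ≤ g ∧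
      (g : ℝ) ≤ (2 * ℓ * 𝒞.size M) ^ (𝒞.d * 𝒞.weight) := by
  choose g hg hg' using 𝒞.exists_growthFactor_le hM hΦ hΘ hℓ
  refine ⟨∏ i, g i, (growth_functions_le M ℓ).trans ?_, ?_⟩
  · push_cast
    exact Finset.prod_le_prod' fun i _ => hg i
  · have h1 := 𝒞.one_le_size hM
    have h0 : (0 : ℝ) ≤ 2 * ℓ * 𝒞.size M := by positivity
    rw [mul_comm (𝒞.d : ℝ), Real.rpow_mul h0, Real.rpow_natCast]
    push_cast
    calc ∏ i, (g i : ℝ) ≤ ∏ _i : Fin 𝒞.d, (2 * ℓ * 𝒞.size M) ^ 𝒞.weight :=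
          Finset.prod_le_prod (fun i _ => Nat.cast_nonneg _) fun i _ => hg' i
      _ = _ := by simp

end CascadeClass

/-- The inequality `x ≤ D log₂ (2 x C)` fails as soon as `x > 2 D log₂ (D e C)`. -/
theorem le_of_le_mul_logb {D C x : ℝ} (hD : 2 ≤ D) (hC : 1 ≤ C) (hx : 0 < x)
    (h : x ≤ D * Real.logb 2 (2 * x * C)) : x ≤ 2 * D * Real.logb 2 (D * Real.exp 1 * C) := by
  have hl2 : 0.6931471803 < Real.log 2 := Real.log_two_gt_d9
  have he : 2.7182818283 < Real.exp 1 := Real.exp_one_gt_d9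
  have hl2' : Real.log 2 < 0.6931471808 := Real.log_two_lt_d9
  have hD0 : 0 < D := by linarith
  have hC0 : 0 < C := by linarith
  simp only [Real.logb] at *
  set l2 := Real.log 2 with hl2def
  set y := Real.log (D * Real.exp 1 * C) with hy
  -- tangent line of the logarithm at `4 D`
  have h1 : Real.log (2 * x * C) = Real.log (x / (4 * D)) + Real.log (8 * D * C) := by
    rw [← Real.log_mul (by positivity) (by positivity)]
    congr 1
    field_simp
    ring
  have h2 : Real.log (x / (4 * D)) ≤ x / (4 * D) - 1 :=
    Real.log_le_sub_one_of_pos (by positivity)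
  have h3 : Real.log (8 * D * C) = 3 * l2 + y - 1 := by
    have : (8 : ℝ) * D * C = 2 ^ 3 * ((D * Real.exp 1 * C) / Real.exp 1) := by
      field_simp
      ring
    rw [this, Real.log_mul (by positivity) (by positivity), Real.log_pow,
      Real.log_div (by positivity) (by positivity), Real.log_exp]
    push_cast
    ring
  have hy1 : 1 + l2 ≤ y := by
    have : y = Real.log D + 1 + Real.log C := by
      rw [hy, Real.log_mul (by positivity) (by positivity),
        Real.log_mul (by positivity) (by positivity), Real.log_exp]
    rw [this]
    have := Real.log_le_log two_pos hD
    have := Real.log_nonneg hC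
    linarith
  have h4 : x * l2 ≤ D * (x / (4 * D) - 1 + (3 * l2 + y - 1)) := by
    have : x ≤ D * Real.log (2 * x * C) / l2 := by rw [mul_div_assoc]; exact h
    rw [le_div_iff₀ (by linarith)] at this
    refine this.trans (mul_le_mul_of_nonneg_left ?_ hD0.le)
    rw [h1, h3]
    linarith
  have h5 : D * (x / (4 * D) - 1 + (3 * l2 + y - 1)) = x / 4 + D * (3 * l2 + y - 2) := by
    field_simp
    ring
  rw [h5] at h4
  have h6 : x * (l2 - 1 / 4) ≤ D * (3 * l2 + y - 2) := by linarith
  rw [← mul_div_assoc, le_div_iff₀ (by linarith)]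
  have h7 : (3 * l2 + y - 2) * l2 ≤ 2 * y * (l2 - 1 / 4) := by
    nlinarith
  have h8 : x * (l2 - 1 / 4) * l2 ≤ 2 * D * y * (l2 - 1 / 4) := by
    calc x * (l2 - 1 / 4) * l2 ≤ D * (3 * l2 + y - 2) * l2 :=
          mul_le_mul_of_nonneg_right h6 (by linarith)
      _ = D * ((3 * l2 + y - 2) * l2) := by ring
      _ ≤ D * (2 * y * (l2 - 1 / 4)) := mul_le_mul_of_nonneg_left h7 hD0.le
      _ = _ := by ring
  have h9 : 0 < l2 - 1 / 4 := by linarith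
  refine le_of_mul_le_mul_right ?_ h9
  linarith

namespace CascadeClass

variable (𝒞 : CascadeClass.{u, v, w})

/-! ### The dimension of a class of cascades -/

theorem two_le_d_mul_weight (hw : 2 ≤ 𝒞.weight) : 2 ≤ 𝒞.d * 𝒞.weight := by
  have : (1 : ℝ) ≤ 𝒞.d := by exact_mod_cast 𝒞.d_pos
  nlinarith

theorem exists_dimension_functions_eq {M : ℕ} (hM : 1 ≤ M) (hΦ : 𝒞.maxDimΦ ≠ ⊤)
    (hΘ : 𝒞.maxDimΘ ≠ ⊤) (hw : 2 ≤ 𝒞.weight) :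
    ∃ n : ℕ, dimension (𝒞.functions M) = n ∧
      (n : ℝ) ≤ 2 * 𝒞.d * 𝒞.weight *
        Real.logb 2 (𝒞.d * 𝒞.weight * Real.exp 1 * M * 𝒞.maxN * 𝒞.maxB) := by
  set b : ℝ := 2 * 𝒞.d * 𝒞.weight *
    Real.logb 2 (𝒞.d * 𝒞.weight * Real.exp 1 * M * 𝒞.maxN * 𝒞.maxB) with hb
  have hD := 𝒞.two_le_d_mul_weight hw
  have hC := 𝒞.one_le_size hM
  have hb' : b = 2 * (𝒞.d * 𝒞.weight) *
      Real.logb 2 (𝒞.d * 𝒞.weight * Real.exp 1 * 𝒞.size M) := by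
    rw [hb, size]
    ring_nf
  have he : 1 ≤ Real.exp 1 := Real.one_le_exp zero_le_one
  have hb0 : 0 ≤ b := by
    rw [hb']
    have h1 : 1 ≤ 𝒞.d * 𝒞.weight * Real.exp 1 * 𝒞.size M :=
      one_le_mul_of_one_le_of_one_le (one_le_mul_of_one_le_of_one_le (by linarith) he) hC
    have := Real.logb_nonneg one_lt_two h1
    positivity
  have hdim : dimension (𝒞.functions M) ≤ (⌊b⌋₊ : ℕ∞) := by
    refine dimension_le_of_growth fun n hn => ?_
    rcases Nat.eq_zero_or_pos n with rfl | hn0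
    · exact Nat.zero_le _
    obtain ⟨g, hg, hg'⟩ := 𝒞.exists_growth_functions_le hM hΦ hΘ hn0
    have h2 : (2 : ℝ) ^ n ≤ (2 * n * 𝒞.size M) ^ (𝒞.d * 𝒞.weight) := by
      have : (2 : ℕ) ^ n ≤ g := by exact_mod_cast hn.trans hg
      exact le_trans (by exact_mod_cast this) hg'
    have hn1 : (0 : ℝ) < n := by exact_mod_cast hn0
    refine Nat.le_floor ?_
    rw [hb']
    refine le_of_le_mul_logb hD hC hn1 ?_
    have h3 := Real.logb_le_logb_of_le one_lt_two (by positivity) h2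
    rwa [Real.logb_rpow_eq_mul_logb_of_pos (by positivity), ← Real.rpow_natCast,
      Real.logb_rpow two_pos (by norm_num)] at h3
  obtain ⟨n, hn⟩ := ENat.ne_top_iff_exists.1 (ne_top_of_le_ne_top (ENat.natCast_ne_top _) hdim)
  rw [← hn] at hdim
  exact ⟨n, hn.symm, (Nat.cast_le.2 (Nat.cast_le.1 hdim)).trans (Nat.floor_le hb0)⟩

end CascadeClass

/-! ### Random signs -/

section Signs

/-- The sign encoded by a Boolean. -/
def sign (b : Bool) : ℝ := if b then -1 else 1

theorem sum_exp_signs_le {n : ℕ} (a : Fin n → ℝ) (ha : ∀ i, |a i| ≤ 1) (r : ℝ) :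
    ∑ s : Fin n → Bool, Real.exp (r * ∑ i, sign (s i) * a i) ≤
      2 ^ n * Real.exp (n * r ^ 2 / 2) := by
  have h1 : ∀ s : Fin n → Bool, Real.exp (r * ∑ i, sign (s i) * a i) =
      ∏ i, Real.exp (r * (sign (s i) * a i)) := fun s => by
    rw [Finset.mul_sum, Real.exp_sum]
  have h2 := Finset.prod_univ_sum (fun _ : Fin n => (Finset.univ : Finset Bool))
    (fun i b => Real.exp (r * (sign b * a i)))
  rw [Fintype.piFinset_univ] at h2
  simp_rw [h1]
  rw [← h2]
  calc ∏ i, ∑ b : Bool, Real.exp (r * (sign b * a i))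
      ≤ ∏ _i : Fin n, 2 * Real.exp (r ^ 2 / 2) := by
        refine Finset.prod_le_prod (fun i _ => by positivity) fun i _ => ?_
        have h3 : ∑ b : Bool, Real.exp (r * (sign b * a i)) = 2 * Real.cosh (r * a i) := by
          simp [sign, Real.cosh_eq]
          ring
        rw [h3]
        refine mul_le_mul_of_nonneg_left ((Real.cosh_le_exp_half_sq _).trans ?_) zero_le_two
        refine Real.exp_le_exp.2 (div_le_div_of_nonneg_right ?_ zero_le_two)
        rw [mul_pow]
        exact mul_le_of_le_one_right (sq_nonneg r) ((sq_le_one_iff_abs_le_one _).2 (ha i))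
    _ = 2 ^ n * Real.exp (n * r ^ 2 / 2) := by
        rw [Finset.prod_const, Finset.card_univ, Fintype.card_fin, mul_pow, ← Real.exp_nat_mul]
        ring_nf

theorem card_signs_lt_le {n : ℕ} (a : Fin n → ℝ) (ha : ∀ i, |a i| ≤ 1) {r : ℝ} (hr : 0 ≤ r) :
    ((Finset.univ.filter fun s : Fin n → Bool => n * r < ∑ i, sign (s i) * a i).card : ℝ) ≤
      2 ^ n * Real.exp (-(n * r ^ 2 / 2)) := by
  have h1 : ((Finset.univ.filter fun s : Fin n → Bool =>
      n * r < ∑ i, sign (s i) * a i).card : ℝ) ≤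
      ∑ s : Fin n → Bool, Real.exp (r * ∑ i, sign (s i) * a i) * Real.exp (-(n * r ^ 2)) := by
    rw [Finset.card_filter]
    push_cast
    refine Finset.sum_le_sum fun s _ => ?_
    rw [← Real.exp_add]
    split_ifs with hs
    · refine Real.one_le_exp ?_
      nlinarith
    · exact (Real.exp_pos _).le
  rw [← Finset.sum_mul] at h1
  refine h1.trans ((mul_le_mul_of_nonneg_right (sum_exp_signs_le a ha r)
    (Real.exp_pos _).le).trans (le_of_eq ?_))
  rw [mul_assoc, ← Real.exp_add]
  ring_nf

theorem card_signs_lt_abs_le {n : ℕ} (a : Fin n → ℝ) (ha : ∀ i, |a i| ≤ 1) {r : ℝ} (hr : 0 ≤ r) :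
    ((Finset.univ.filter fun s : Fin n → Bool => n * r < |∑ i, sign (s i) * a i|).card : ℝ) ≤
      2 ^ n * (2 * Real.exp (-(n * r ^ 2 / 2))) := by
  have h1 := card_signs_lt_le a ha hr
  have h2 := card_signs_lt_le (fun i => -a i) (fun i => by rw [abs_neg]; exact ha i) hr
  have hsub : (Finset.univ.filter fun s : Fin n → Bool => n * r < |∑ i, sign (s i) * a i|) ⊆
      (Finset.univ.filter fun s : Fin n → Bool => n * r < ∑ i, sign (s i) * a i) ∪
        (Finset.univ.filter fun s : Fin n → Bool => n * r < ∑ i, sign (s i) * -a i) := by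
    intro s hs
    simpa [lt_abs] using hs
  have h3 : ((Finset.univ.filter fun s : Fin n → Bool =>
      n * r < |∑ i, sign (s i) * a i|).card : ℝ) ≤ _ :=
    Nat.cast_le.2 ((Finset.card_le_card hsub).trans (Finset.card_union_le _ _))
  push_cast at h3
  linarith

/-- The permutation of a double sample that exchanges the two copies at the indices in `s`. -/
def exchange {n : ℕ} (s : Fin n → Bool) : Equiv.Perm (Fin n ⊕ Fin n) :=
  Function.Involutive.toPerm
    (Sum.elim (fun i => if s i then .inr i else .inl i) (fun i => if s i then .inl i else .inr i))
    (by rintro (i | i) <;> cases h : s i <;> simp [h])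

theorem sub_exchange {n : ℕ} (s : Fin n → Bool) (h : Fin n ⊕ Fin n → ℝ) (i : Fin n) :
    h (exchange s (.inl i)) - h (exchange s (.inr i)) =
      sign (s i) * (h (.inl i) - h (.inr i)) := by
  have h1 : exchange s (.inl i) = if s i then .inr i else .inl i := rfl
  have h2 : exchange s (.inr i) = if s i then .inl i else .inr i := rfl
  cases hs : s i <;> simp [h1, h2, sign, hs]

end Signs

/-! ### Uniform deviations over a class of bounded functions -/

section Deviation

variable {X : Type*}

/-- The double samples on which the two empirical means of some function of the class differ by
more than `δ`. -/
def doubleDeviation (G : Set (X → ℝ)) (n : ℕ) (δ : ℝ) : Set (Fin n ⊕ Fin n → X) :=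
  {z | ∃ g ∈ G, n * δ < |∑ i, (g (z (.inl i)) - g (z (.inr i)))|}

theorem card_exchange_mem_doubleDeviation_le {G : Set (X → ℝ)}
    (hG : ∀ g ∈ G, ∀ x, g x ∈ Set.Icc (0 : ℝ) 1) {n N : ℕ} {δ : ℝ} (hδ : 0 ≤ δ)
    (z : Fin n ⊕ Fin n → X) (hN : ((fun (g : X → ℝ) i => g (z i)) '' G).encard ≤ N)
    [DecidablePred fun s : Fin n → Bool => z ∘ exchange s ∈ doubleDeviation G n δ] :
    ((Finset.univ.filter fun s : Fin n → Bool =>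
      z ∘ exchange s ∈ doubleDeviation G n δ).card : ℝ) ≤
      2 ^ n * (2 * N * Real.exp (-(n * δ ^ 2 / 2))) := by
  classical
  have hfin : ((fun (g : X → ℝ) i => g (z i)) '' G).Finite :=
    Set.finite_of_encard_le_coe hN
  have hsub : (Finset.univ.filter fun s : Fin n → Bool =>
      z ∘ exchange s ∈ doubleDeviation G n δ) ⊆ hfin.toFinset.biUnion fun p =>
        Finset.univ.filter fun s : Fin n → Bool =>
          n * δ < |∑ i, sign (s i) * (p (.inl i) - p (.inr i))| := by
    intro s hs
    obtain ⟨g, hg, h⟩ := (Finset.mem_filter.1 hs).2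
    refine Finset.mem_biUnion.2 ⟨fun i => g (z i), by simpa using ⟨g, hg, rfl⟩,
      Finset.mem_filter.2 ⟨Finset.mem_univ _, ?_⟩⟩
    simpa only [Function.comp_apply, sub_exchange s (fun i => g (z i))] using h
  have hcard : hfin.toFinset.card ≤ N := by
    rw [hfin.encard_eq_coe_toFinset_card] at hN
    exact_mod_cast hN
  have h1 : ((Finset.univ.filter fun s : Fin n → Bool =>
      z ∘ exchange s ∈ doubleDeviation G n δ).card : ℝ) ≤
      ∑ p ∈ hfin.toFinset, ((Finset.univ.filter fun s : Fin n → Bool =>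
          n * δ < |∑ i, sign (s i) * (p (.inl i) - p (.inr i))|).card : ℝ) := by
    exact_mod_cast (Finset.card_le_card hsub).trans Finset.card_biUnion_le
  refine h1.trans ((Finset.sum_le_sum fun p hp => card_signs_lt_abs_le
    (fun i => p (.inl i) - p (.inr i)) (fun i => ?_) hδ).trans ?_)
  · obtain ⟨g, hg, rfl⟩ := hfin.mem_toFinset.1 hp
    have h2 := hG g hg (z (.inl i))
    have h3 := hG g hg (z (.inr i))
    exact abs_le.2 ⟨by linarith [h2.1, h3.2], by linarith [h2.2, h3.1]⟩
  · rw [Finset.sum_const, nsmul_eq_mul]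
    have : (hfin.toFinset.card : ℝ) ≤ N := by exact_mod_cast hcard
    have h4 := mul_le_mul_of_nonneg_right this
      (by positivity : 0 ≤ (2 : ℝ) ^ n * (2 * Real.exp (-(n * δ ^ 2 / 2))))
    linarith

variable [MeasurableSpace X]

theorem measurePreserving_reindex {ι κ : Type*} [Fintype ι] [Fintype κ] (e : κ ≃ ι)
    (P : Measure X) [IsProbabilityMeasure P] :
    MeasurePreserving (fun z : ι → X => z ∘ e) (Measure.pi fun _ => P) (Measure.pi fun _ => P) := by
  have h := measurePreserving_piCongrLeft (α := fun _ : κ => X) (fun _ => P) e.symm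
  convert h using 1
  funext z k
  simp [MeasurableEquiv.piCongrLeft, Equiv.piCongrLeft_apply]

theorem measure_deviation_le_half (P : Measure X) [IsProbabilityMeasure P] {g : X → ℝ}
    (hg : Measurable g) (hg01 : ∀ x, g x ∈ Set.Icc (0 : ℝ) 1) {n : ℕ} {δ : ℝ} (hδ : 0 < δ)
    (hn : 1 / 2 ≤ n * δ ^ 2) :
    Measure.pi (fun _ : Fin n => P) {x | n * δ ≤ |∑ i, g (x i) - n * ∫ x, g x ∂P|} ≤ 1 / 2 := by
  have hn0 : (0 : ℝ) < n := by
    rcases Nat.eq_zero_or_pos n with rfl | h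
    · norm_num at hn
    · exact_mod_cast h
  have hmem : ∀ _i : Fin n, MemLp g 2 P := fun _ =>
    MemLp.of_bound hg.aestronglyMeasurable 1 (.of_forall fun x => by
      rw [Real.norm_eq_abs, abs_le]
      exact ⟨by linarith [(hg01 x).1], (hg01 x).2⟩)
  have hmem' : ∀ i : Fin n, MemLp (fun x : Fin n → X => g (x i)) 2
      (Measure.pi fun _ : Fin n => P) := fun i =>
    (hmem i).comp_measurePreserving (measurePreserving_eval (fun _ : Fin n => P) i)
  have hmean : ∫ x, (∑ i, fun x : Fin n → X => g (x i)) x ∂(Measure.pi fun _ : Fin n => P) =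
      n * ∫ x, g x ∂P := by
    simp only [Finset.sum_apply]
    rw [integral_finsetSum _ fun i _ => (hmem' i).integrable one_le_two]
    rw [Finset.sum_congr rfl fun i _ =>
      integral_comp_eval (μ := fun _ : Fin n => P) (i := i) hg.aestronglyMeasurable]
    simp
  have hvar := ProbabilityTheory.variance_sum_pi (μ := fun _ : Fin n => P) (X := fun _ => g) hmem
  have hvar1 : ProbabilityTheory.variance g P ≤ 1 / 4 := by
    refine (ProbabilityTheory.variance_le_sq_of_bounded (a := 0) (b := 1)
      (.of_forall hg01) hg.aemeasurable).trans (by norm_num)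
  have hcheb := ProbabilityTheory.meas_ge_le_variance_div_sq
    (memLp_finsetSum' Finset.univ fun i _ => hmem' i) (mul_pos hn0 hδ)
  rw [hmean, hvar] at hcheb
  simp only [Finset.sum_apply] at hcheb
  refine hcheb.trans ?_
  rw [show (1 / 2 : ENNReal) = ENNReal.ofReal (1 / 2) by
    rw [ENNReal.ofReal_div_of_pos two_pos]; simp]
  refine ENNReal.ofReal_le_ofReal ?_
  rw [Finset.sum_const, Finset.card_univ, Fintype.card_fin, nsmul_eq_mul,
    div_le_div_iff₀ (by positivity) two_pos]
  nlinarith [mul_le_mul_of_nonneg_left hvar1 hn0.le, mul_le_mul_of_nonneg_left hn hn0.le]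

/-- Symmetrization by a second sample. -/
theorem measure_deviation_le_doubleDeviation (P : Measure X) [IsProbabilityMeasure P]
    {G : Set (X → ℝ)} (hG : ∀ g ∈ G, Measurable g ∧ ∀ x, g x ∈ Set.Icc (0 : ℝ) 1) {n : ℕ} {δ : ℝ}
    (hδ : 0 < δ) (hn : 1 / 2 ≤ n * δ ^ 2) :
    Measure.pi (fun _ : Fin n => P)
        {x | ∃ g ∈ G, n * (2 * δ) < |∑ i, g (x i) - n * ∫ x, g x ∂P|} ≤
      2 * Measure.pi (fun _ : Fin n ⊕ Fin n => P) (doubleDeviation G n δ) := by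
  set μ := Measure.pi (fun _ : Fin n => P)
  set μ₂ := Measure.pi (fun _ : Fin n ⊕ Fin n => P)
  set T := toMeasurable μ₂ (doubleDeviation G n δ)
  have hT : MeasurableSet T := measurableSet_toMeasurable _ _
  have hmp := measurePreserving_sumPiEquivProdPi_symm (X := fun _ : Fin n ⊕ Fin n => X)
    (fun _ => P)
  have hT' : MeasurableSet ((MeasurableEquiv.sumPiEquivProdPi fun _ : Fin n ⊕ Fin n => X).symm ⁻¹'
    T) := hmp.measurable hT
  have hfub : μ₂ (doubleDeviation G n δ) = ∫⁻ x, μ (Prod.mk x ⁻¹'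
      ((MeasurableEquiv.sumPiEquivProdPi fun _ : Fin n ⊕ Fin n => X).symm ⁻¹' T)) ∂μ := by
    rw [← measure_toMeasurable, ← hmp.measure_preimage hT.nullMeasurableSet,
      Measure.prod_apply hT']
  have hmarkov := mul_meas_ge_le_lintegral (μ := μ) (measurable_measure_prodMk_left (ν := μ) hT')
    (1 / 2)
  rw [← hfub] at hmarkov
  have hsub : {x | ∃ g ∈ G, n * (2 * δ) < |∑ i, g (x i) - n * ∫ x, g x ∂P|} ⊆
      {x | 1 / 2 ≤ μ (Prod.mk x ⁻¹'
        ((MeasurableEquiv.sumPiEquivProdPi fun _ : Fin n ⊕ Fin n => X).symm ⁻¹' T))} := by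
    rintro x ⟨g, hg, hx⟩
    have hhalf := measure_deviation_le_half P (hG g hg).1 (hG g hg).2 hδ hn
    have hgm := (hG g hg).1
    have hmeas : MeasurableSet {x : Fin n → X | n * δ ≤ |∑ i, g (x i) - n * ∫ x, g x ∂P|} := by
      refine measurableSet_le measurable_const ?_
      fun_prop
    have hcompl : 1 / 2 ≤ μ {x : Fin n → X | n * δ ≤ |∑ i, g (x i) - n * ∫ x, g x ∂P|}ᶜ := by
      rw [prob_compl_eq_one_sub hmeas]
      refine ENNReal.le_sub_of_add_le_left (ne_top_of_le_ne_top (by simp) hhalf) ?_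
      refine (add_le_add_left hhalf _).trans ?_
      rw [ENNReal.add_halves]
    refine hcompl.trans (measure_mono fun x' hx' => subset_toMeasurable _ _ ⟨g, hg, ?_⟩)
    simp only [Set.mem_compl_iff, Set.mem_ofPred_eq, not_le] at hx'
    change n * δ < |∑ i, (g (x i) - g (x' i))|
    rw [Finset.sum_sub_distrib]
    have := abs_sub_abs_le_abs_sub (∑ i, g (x i) - n * ∫ x, g x ∂P)
      (∑ i, g (x' i) - n * ∫ x, g x ∂P)
    rw [sub_sub_sub_cancel_right] at this
    linarith
  calc μ {x | ∃ g ∈ G, n * (2 * δ) < |∑ i, g (x i) - n * ∫ x, g x ∂P|}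
      ≤ 2 * (1 / 2 * μ {x | 1 / 2 ≤ μ (Prod.mk x ⁻¹'
        ((MeasurableEquiv.sumPiEquivProdPi fun _ : Fin n ⊕ Fin n => X).symm ⁻¹' T))}) := by
        rw [← mul_assoc (2 : ENNReal) (1 / 2), ENNReal.mul_div_cancel two_ne_zero ENNReal.ofNat_ne_top, one_mul]
        exact measure_mono hsub
    _ ≤ _ := mul_le_mul_right hmarkov _

theorem measure_doubleDeviation_le (P : Measure X) [IsProbabilityMeasure P]
    {G : Set (X → ℝ)} (hG : ∀ g ∈ G, ∀ x, g x ∈ Set.Icc (0 : ℝ) 1) {n N : ℕ} {δ : ℝ} (hδ : 0 ≤ δ)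
    (hmeas : NullMeasurableSet (doubleDeviation G n δ) (Measure.pi fun _ : Fin n ⊕ Fin n => P))
    (hN : ∀ z : Fin n ⊕ Fin n → X, ((fun (g : X → ℝ) i => g (z i)) '' G).encard ≤ N) :
    Measure.pi (fun _ : Fin n ⊕ Fin n => P) (doubleDeviation G n δ) ≤
      ENNReal.ofReal (2 * N * Real.exp (-(n * δ ^ 2 / 2))) := by
  classical
  set μ₂ := Measure.pi (fun _ : Fin n ⊕ Fin n => P)
  set B := doubleDeviation G n δ
  have hmp : ∀ s : Fin n → Bool, MeasurePreserving
      (fun z : Fin n ⊕ Fin n → X => z ∘ exchange s) μ₂ μ₂ := fun s =>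
    measurePreserving_reindex (exchange s) P
  have hnull : ∀ s : Fin n → Bool, NullMeasurableSet
      ((fun z : Fin n ⊕ Fin n → X => z ∘ exchange s) ⁻¹' B) μ₂ := fun s =>
    hmeas.preimage (hmp s).quasiMeasurePreserving
  have hsum : (2 : ENNReal) ^ n * μ₂ B ≤
      2 ^ n * ENNReal.ofReal (2 * N * Real.exp (-(n * δ ^ 2 / 2))) := by
    calc (2 : ENNReal) ^ n * μ₂ B
        = ∑ s : Fin n → Bool, μ₂ ((fun z : Fin n ⊕ Fin n → X => z ∘ exchange s) ⁻¹' B) := by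
          rw [Finset.sum_congr rfl fun s _ => (hmp s).measure_preimage hmeas]
          simp
      _ = ∫⁻ z, ∑ s : Fin n → Bool,
            ((fun z : Fin n ⊕ Fin n → X => z ∘ exchange s) ⁻¹' B).indicator 1 z ∂μ₂ := by
          rw [lintegral_finsetSum' _ fun s _ => (measurable_one.aemeasurable).indicator₀ (hnull s)]
          exact Finset.sum_congr rfl fun s _ => (lintegral_indicator_one₀ (hnull s)).symm
      _ ≤ ∫⁻ _z, ENNReal.ofReal (2 ^ n * (2 * N * Real.exp (-(n * δ ^ 2 / 2)))) ∂μ₂ := by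
          refine lintegral_mono fun z => ?_
          have h1 := card_exchange_mem_doubleDeviation_le hG hδ z (hN z)
          have h2 : ∑ s : Fin n → Bool,
              ((fun z : Fin n ⊕ Fin n → X => z ∘ exchange s) ⁻¹' B).indicator
                (1 : (Fin n ⊕ Fin n → X) → ENNReal) z =
              ((Finset.univ.filter fun s : Fin n → Bool => z ∘ exchange s ∈ B).card : ENNReal) := by
            simp [Set.indicator_apply]
          refine h2.le.trans ?_
          rw [← ENNReal.ofReal_natCast]
          exact ENNReal.ofReal_le_ofReal h1
      _ = _ := by
          rw [lintegral_const, measure_univ, mul_one, ENNReal.ofReal_mul (by positivity),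
            ENNReal.ofReal_pow zero_le_two]
          simp
  exact (ENNReal.mul_le_mul_iff_right (by simp) (by simp)).1 hsum

end Deviation

/-! ### Learning by empirical risk minimization -/

section Learning

variable {X Y : Type*}

/-- The loss `x ↦ L(f(x), f₀(x))` as a real-valued function. -/
def lossFun (L : Y → Y → Fin 2) (f₀ f : X → Y) (x : X) : ℝ := ((L (f x) (f₀ x) : ℕ) : ℝ)

theorem lossFun_mem_Icc (L : Y → Y → Fin 2) (f₀ f : X → Y) (x : X) :
    lossFun L f₀ f x ∈ Set.Icc (0 : ℝ) 1 := by
  refine ⟨Nat.cast_nonneg _, ?_⟩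
  have : (L (f x) (f₀ x) : ℕ) ≤ 1 := Nat.lt_succ_iff.1 (L (f x) (f₀ x)).2
  unfold lossFun
  exact_mod_cast this

theorem encard_lossFun_patterns_le (L : Y → Y → Fin 2) (f₀ : X → Y) (F : Set (X → Y)) {n : ℕ}
    (z : Fin n ⊕ Fin n → X) :
    ((fun (g : X → ℝ) i => g (z i)) '' (lossFun L f₀ '' F)).encard ≤ growth F (n + n) := by
  refine le_trans ?_ (encard_image_eval_le_growth F z (by simp))
  rw [Set.image_image]
  refine encard_image_le_of_determined fun f _ f' _ h => funext fun i => ?_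
  have := congrFun h i
  simp only [lossFun, this]

variable [MeasurableSpace X]

theorem measurable_lossFun [Finite Y] (L : Y → Y → Fin 2) {f₀ f : X → Y}
    (hf₀ : MeasurableLabels f₀) (hf : MeasurableLabels f) : Measurable (lossFun L f₀ f) := by
  let _ : MeasurableSpace Y := ⊤
  have h₀ : Measurable f₀ := measurable_to_countable' hf₀
  have h : Measurable f := measurable_to_countable' hf
  have hL : Measurable fun p : Y × Y => ((L p.1 p.2 : ℕ) : ℝ) := Measurable.of_discrete
  exact hL.comp (h.prodMk h₀)

theorem Permissible.nullMeasurableSet_pattern {F : Set (X → Y)} (hF : Permissible F)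
    (P : Measure X) [IsProbabilityMeasure P] {ι : Type*} [Fintype ι] (y : ι → Y) :
    NullMeasurableSet {z : ι → X | ∃ f ∈ F, ∀ i, f (z i) = y i} (Measure.pi fun _ => P) := by
  let e := (Fintype.equivFin ι).symm
  have h := (hF.2 P (Fintype.card ι) (y ∘ e)).preimage
    (measurePreserving_reindex e P).quasiMeasurePreserving
  convert h using 1
  ext z
  simp only [Set.mem_ofPred_eq, Set.mem_preimage, Function.comp_apply]
  exact exists_congr fun f => and_congr_right fun _ =>
    (e.forall_congr_right (q := fun i => f (z i) = y i)).symm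

theorem nullMeasurableSet_doubleDeviation [Finite Y] {F : Set (X → Y)} (hF : Permissible F)
    (L : Y → Y → Fin 2) (P : Measure X) [IsProbabilityMeasure P] {f₀ : X → Y}
    (hf₀ : MeasurableLabels f₀) (n : ℕ) (δ : ℝ) :
    NullMeasurableSet (doubleDeviation (lossFun L f₀ '' F) n δ)
      (Measure.pi fun _ : Fin n ⊕ Fin n => P) := by
  let l : (Fin n ⊕ Fin n → Y) × (Fin n ⊕ Fin n → Y) → Fin n ⊕ Fin n → ℝ :=
    fun p i => ((L (p.1 i) (p.2 i) : ℕ) : ℝ)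
  have heq : doubleDeviation (lossFun L f₀ '' F) n δ =
      ⋃ (p : (Fin n ⊕ Fin n → Y) × (Fin n ⊕ Fin n → Y))
        (_ : n * δ < |∑ i, (l p (.inl i) - l p (.inr i))|),
        ({z | ∃ f ∈ F, ∀ i, f (z i) = p.1 i} ∩ {z | ∀ i, f₀ (z i) = p.2 i}) := by
    ext z
    simp only [Set.mem_iUnion, Set.mem_inter_iff, Set.mem_ofPred_eq, exists_prop]
    constructor
    · rintro ⟨_, ⟨f, hf, rfl⟩, h⟩
      exact ⟨(fun i => f (z i), fun i => f₀ (z i)), h, ⟨f, hf, fun _ => rfl⟩, fun _ => rfl⟩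
    · rintro ⟨p, h, ⟨f, hf, h1⟩, h2⟩
      refine ⟨_, ⟨f, hf, rfl⟩, ?_⟩
      simpa only [lossFun, h1, h2] using h
  rw [heq]
  refine NullMeasurableSet.iUnion fun p => NullMeasurableSet.iUnion fun _ =>
    (hF.nullMeasurableSet_pattern P p.1).inter (MeasurableSet.nullMeasurableSet ?_)
  rw [show {z : Fin n ⊕ Fin n → X | ∀ i, f₀ (z i) = p.2 i} =
    ⋂ i, (fun z : Fin n ⊕ Fin n → X => z i) ⁻¹' (f₀ ⁻¹' {p.2 i}) by ext; simp]
  exact MeasurableSet.iInter fun i => measurable_pi_apply i (hf₀ _)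

/-- Uniform convergence of the empirical risks over a class of bounded growth. -/
theorem measure_risk_deviation_le [Finite Y] {F : Set (X → Y)} (hF : Permissible F)
    (L : Y → Y → Fin 2) (P : Measure X) [IsProbabilityMeasure P] {f₀ : X → Y}
    (hf₀ : MeasurableLabels f₀) {n N : ℕ} {δ : ℝ} (hδ : 0 < δ) (hn : 1 / 2 ≤ n * δ ^ 2)
    (hN : growth F (n + n) ≤ N) :
    Measure.pi (fun _ : Fin n => P)
        {x | ∃ f ∈ F, n * (2 * δ) < |∑ i, lossFun L f₀ f (x i) - n * risk L P f₀ f|} ≤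
      ENNReal.ofReal (4 * N * Real.exp (-(n * δ ^ 2 / 2))) := by
  have h1 := measure_deviation_le_doubleDeviation P (G := lossFun L f₀ '' F)
    (by
      rintro _ ⟨f, hf, rfl⟩
      exact ⟨measurable_lossFun L hf₀ (hF.1 f hf), lossFun_mem_Icc L f₀ f⟩) hδ hn
  have h2 := measure_doubleDeviation_le P (G := lossFun L f₀ '' F)
    (by
      rintro _ ⟨f, hf, rfl⟩
      exact lossFun_mem_Icc L f₀ f) hδ.le (nullMeasurableSet_doubleDeviation hF L P hf₀ n δ)
    (fun z => (encard_lossFun_patterns_le L f₀ F z).trans hN)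
  simp only [Set.exists_mem_image] at h1
  refine h1.trans ((mul_le_mul_right h2 _).trans (le_of_eq ?_))
  rw [← ENNReal.ofReal_ofNat, ← ENNReal.ofReal_mul (by norm_num)]
  congr 1
  ring

theorem sufficientSize_of_growth_le [Finite Y] {F : Set (X → Y)} (hF : Permissible F)
    (hne : F.Nonempty) (L : Y → Y → Fin 2) {ε η : ℝ} (hε : 0 < ε) {n N : ℕ}
    (hn : 1 / 2 ≤ n * (ε / 4) ^ 2) (hN : growth F (n + n) ≤ N)
    (hη : 4 * N * Real.exp (-(n * (ε / 4) ^ 2 / 2)) ≤ η) : SufficientSize F L ε η n := by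
  have : Nonempty F := hne.to_subtype
  let emp : (Fin n → X × Y) → F → ℕ := fun S f => ∑ i, (L (f.1 (S i).1) (S i).2 : ℕ)
  refine ⟨fun S => Function.argmin (emp S), fun P _ f₀ hf₀ => ?_⟩
  refine le_trans (measure_mono fun x hx => ?_) ((measure_risk_deviation_le hF L P hf₀
    (by positivity : 0 < ε / 4) hn hN).trans (ENNReal.ofReal_le_ofReal hη))
  have hn0 : (0 : ℝ) < n := by
    rcases Nat.eq_zero_or_pos n with rfl | h
    · norm_num at hn
    · exact_mod_cast h
  by_contra hcon
  simp only [Set.mem_ofPred_eq, not_exists, not_and, not_lt] at hcon hx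
  refine not_le.2 hx ?_
  set S : Fin n → X × Y := fun i => (x i, f₀ (x i))
  set fhat := Function.argmin (emp S)
  have hemp : ∀ f : F, ∑ i, lossFun L f₀ f.1 (x i) = emp S f := fun f => by
    simp [emp, lossFun, S]
  rw [sub_le_comm]
  refine le_ciInf fun f => ?_
  have h1 := (abs_le.1 (hcon fhat.1 fhat.2)).1
  have h2 := (abs_le.1 (hcon f.1 f.2)).2
  have h3 : (emp S fhat : ℝ) ≤ emp S f := Nat.cast_le.2 (Function.argmin_le (emp S) f)
  rw [hemp] at h1 h2
  have h4 : n * (risk L P f₀ fhat.1 - ε) ≤ n * risk L P f₀ f.1 := by linarith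
  exact le_of_mul_le_mul_left h4 hn0

end Learning

/-! ### The sample complexity of a class of cascades -/

theorem exists_sample_constant {c : ℝ} (hc : 0 < c) (b r : ℝ) :
    ∃ K : ℝ, 1 ≤ K ∧ b ≤ K ∧ r + Real.log (8 * K) ≤ K * c := by
  have h1 := Real.isLittleO_log_id_atTop.bound (half_pos hc)
  obtain ⟨K, hK, hK1, hKb, hKr⟩ := (h1.and ((Filter.eventually_ge_atTop 1).and
    ((Filter.eventually_ge_atTop b).and
      (Filter.eventually_ge_atTop ((r + Real.log 8) / (c / 2)))))).exists
  refine ⟨K, hK1, hKb, ?_⟩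
  rw [div_le_iff₀ (half_pos hc)] at hKr
  rw [Real.norm_eq_abs, Real.norm_eq_abs, id, abs_of_pos (by linarith : (0 : ℝ) < K)] at hK
  rw [Real.log_mul (by norm_num) (by linarith)]
  linarith [le_abs_self (Real.log K)]

theorem failure_probability_le {c η K D C : ℝ} (hη : 0 < η) (hK : 1 ≤ K) (hD : 2 ≤ D)
    (hC : 1 ≤ C) (hKc : 3 + |Real.log η| + Real.log (8 * K) ≤ K * c) {n : ℝ}
    (hn : K * (D * Real.logb 2 (D * C)) ≤ n) (hn' : n ≤ 2 * (K * (D * Real.logb 2 (D * C))))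
    (hc : 0 < c) :
    4 * (2 * (2 * n) * C) ^ D * Real.exp (-(n * c)) ≤ η := by
  set lam := Real.logb 2 (D * C) with hlam
  have hDC : 2 ≤ D * C := by nlinarith
  have hlam1 : 1 ≤ lam := by
    rw [hlam, Real.le_logb_iff_rpow_le one_lt_two (by linarith), Real.rpow_one]
    exact hDC
  have hlam0 : 0 < lam := by linarith
  have hD0 : 0 < D := by linarith
  have hC0 : 0 < C := by linarith
  have hK0 : 0 < K := by linarith
  have hU : D ≤ D * lam := le_mul_of_one_le_right hD0.le hlam1
  have hn0 : 0 < n := lt_of_lt_of_le (by positivity) hn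
  have hlog2 : Real.log 2 ≤ 1 := by linarith [Real.log_two_lt_d9]
  have hlogDC : Real.log (D * C) ≤ lam := by
    have : Real.log (D * C) = lam * Real.log 2 := by
      rw [hlam, Real.logb, div_mul_cancel₀ _ (Real.log_pos one_lt_two).ne']
    rw [this]
    exact mul_le_of_le_one_right hlam0.le hlog2
  have hloglam : Real.log lam ≤ lam := by linarith [Real.log_le_sub_one_of_pos hlam0]
  have hlogK : 0 ≤ Real.log (8 * K) := Real.log_nonneg (by linarith)
  have h1 : Real.log (2 * (2 * n) * C) ≤ Real.log (8 * K) + 2 * lam := by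
    have h2 : Real.log (2 * (2 * n) * C) ≤ Real.log (8 * K * (D * C) * lam) := by
      refine Real.log_le_log (by positivity) ?_
      nlinarith [mul_le_mul_of_nonneg_right hn' hC0.le]
    have h3 : Real.log (8 * K * (D * C) * lam) =
        Real.log (8 * K) + Real.log (D * C) + Real.log lam := by
      rw [Real.log_mul (by positivity) (by positivity),
        Real.log_mul (by positivity) (by positivity)]
    linarith
  have hlog4 : Real.log 4 ≤ 2 := by
    rw [show (4 : ℝ) = 2 ^ 2 by norm_num, Real.log_pow]
    push_cast
    linarith
  have h3 : Real.log 4 + D * Real.log (2 * (2 * n) * C) - n * c ≤ Real.log η := by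
    have h4 := mul_le_mul_of_nonneg_left h1 hD0.le
    have h5 : D * lam * (3 + |Real.log η| + Real.log (8 * K)) ≤ D * lam * (K * c) :=
      mul_le_mul_of_nonneg_left hKc (by positivity)
    have h6 := mul_le_mul_of_nonneg_right hn hc.le
    have h7 : D * Real.log (8 * K) ≤ D * lam * Real.log (8 * K) :=
      mul_le_mul_of_nonneg_right hU hlogK
    have h8 : |Real.log η| ≤ D * lam * |Real.log η| :=
      le_mul_of_one_le_left (abs_nonneg _) (by linarith)
    have h9 := neg_abs_le (Real.log η)
    nlinarith
  have hpos : (0 : ℝ) < 2 * (2 * n) * C := by positivity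
  calc 4 * (2 * (2 * n) * C) ^ D * Real.exp (-(n * c))
      = Real.exp (Real.log 4 + D * Real.log (2 * (2 * n) * C) - n * c) := by
        rw [sub_eq_add_neg, Real.exp_add, Real.exp_add, Real.exp_log (by norm_num),
          Real.rpow_def_of_pos hpos, mul_comm D]
    _ ≤ Real.exp (Real.log η) := Real.exp_le_exp.2 h3
    _ = η := Real.exp_log hη

theorem exists_sampleComplexity_bound (ε η : ℝ) (hε : 0 < ε) (hη : 0 < η) : ∃ K : ℝ,
    ∀ (𝒞 : CascadeClass.{u, v, w}) (M : ℕ), 1 ≤ M →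
      𝒞.maxDimΦ ≠ ⊤ → 𝒞.maxDimΘ ≠ ⊤ → 2 ≤ 𝒞.weight →
      ∀ [MeasurableSpace (Str 𝒞.S M)] (L : 𝒞.B 𝒞.last → 𝒞.B 𝒞.last → Fin 2),
      Permissible (𝒞.functions M) →
      ∃ n : ℕ, sampleComplexity (𝒞.functions M) L ε η = n ∧
        (n : ℝ) ≤ K * (𝒞.d * 𝒞.weight *
          Real.logb 2 (𝒞.d * 𝒞.weight * M * 𝒞.maxN * 𝒞.maxB)) := by
  have hc : 0 < (ε / 4) ^ 2 / 2 := by positivity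
  obtain ⟨K, hK1, hKb, hKc⟩ := exists_sample_constant hc (1 / (2 * (ε / 4) ^ 2))
    (3 + |Real.log η|)
  refine ⟨2 * K, fun 𝒞 M hM hΦ hΘ hw _ L hperm => ?_⟩
  have hD := 𝒞.two_le_d_mul_weight hw
  have hC := 𝒞.one_le_size hM
  have hsize : (𝒞.d * 𝒞.weight * M * 𝒞.maxN * 𝒞.maxB : ℝ) = 𝒞.d * 𝒞.weight * 𝒞.size M := by
    rw [CascadeClass.size]
    ring
  rw [hsize]
  set U : ℝ := 𝒞.d * 𝒞.weight * Real.logb 2 (𝒞.d * 𝒞.weight * 𝒞.size M) with hU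
  have hU1 : 1 ≤ U := by
    have : 1 ≤ Real.logb 2 (𝒞.d * 𝒞.weight * 𝒞.size M) := by
      rw [Real.le_logb_iff_rpow_le one_lt_two (by nlinarith), Real.rpow_one]
      nlinarith
    rw [hU]
    nlinarith
  have hKU : 1 ≤ K * U := one_le_mul_of_one_le_of_one_le hK1 hU1
  set n := ⌈K * U⌉₊ with hn
  have hn1 : K * U ≤ n := Nat.le_ceil _
  have hn2 : (n : ℝ) ≤ 2 * (K * U) := by
    have := (Nat.ceil_lt_add_one (by linarith : 0 ≤ K * U)).le
    linarith
  have hnpos : 1 ≤ n + n := by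
    have : 0 < n := Nat.ceil_pos.2 (by linarith)
    omega
  obtain ⟨N, hN, hN'⟩ := 𝒞.exists_growth_functions_le hM hΦ hΘ hnpos
  have hfin := 𝒞.B_finite 𝒞.last
  have hhalf : 1 / 2 ≤ n * (ε / 4) ^ 2 := by
    have h1 : K ≤ n := le_trans (le_mul_of_one_le_right (by linarith) hU1) hn1
    rw [div_le_iff₀ (by positivity)] at hKb
    have := mul_le_mul_of_nonneg_right h1 (sq_nonneg (ε / 4))
    linarith
  have hsuff : SufficientSize (𝒞.functions M) L ε η n := by
    refine sufficientSize_of_growth_le hperm (𝒞.functions_nonempty M) L hε hhalf hN ?_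
    refine le_trans ?_ (failure_probability_le hη hK1 hD hC hKc hn1 hn2 hc)
    rw [mul_div_assoc]
    refine mul_le_mul_of_nonneg_right ?_ (Real.exp_pos _).le
    refine mul_le_mul_of_nonneg_left (hN'.trans (le_of_eq ?_)) (by norm_num)
    push_cast
    ring_nf
  have hle : sampleComplexity (𝒞.functions M) L ε η ≤ n :=
    iInf₂_le (f := fun (ℓ : ℕ) (_ : SufficientSize (𝒞.functions M) L ε η ℓ) => (ℓ : ℕ∞)) n hsuff
  obtain ⟨m, hm⟩ := ENat.ne_top_iff_exists.1 (ne_top_of_le_ne_top (ENat.natCast_ne_top n) hle)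
  rw [← hm] at hle ⊢
  refine ⟨m, rfl, ?_⟩
  have : (m : ℝ) ≤ n := Nat.cast_le.2 (Nat.cast_le.1 hle)
  linarith

end AutomataCascade

theorem mainTheorem1 :
    -- (i) growth
    (∀ (𝒞 : AutomataCascade.CascadeClass) (M : ℕ), 1 ≤ M → ∀ ℓ : ℕ,
      AutomataCascade.growth (𝒞.functions M) ℓ ≤
        ∏ i : Fin 𝒞.d,
          (AutomataCascade.projections (𝒞.X i) (𝒞.a i) (𝒞.m i)).encard * (𝒞.Δ i).encard *
            AutomataCascade.growth (𝒞.Φ i) (ℓ * M) * AutomataCascade.growth (𝒞.Θ i) (ℓ * M)) ∧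
    -- (ii) dimension
    (∀ (𝒞 : AutomataCascade.CascadeClass) (M : ℕ), 1 ≤ M →
      𝒞.maxDimΦ ≠ ⊤ → 𝒞.maxDimΘ ≠ ⊤ → 2 ≤ 𝒞.weight →
      ∃ n : ℕ, AutomataCascade.dimension (𝒞.functions M) = n ∧
        (n : ℝ) ≤ 2 * 𝒞.d * 𝒞.weight *
          Real.logb 2 (𝒞.d * 𝒞.weight * Real.exp 1 * M * 𝒞.maxN * 𝒞.maxB)) ∧
    -- (iii) sample complexity, for fixed precision and confidence
    (∀ ε η : ℝ, 0 < ε → 0 < η → ∃ K : ℝ,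
      ∀ (𝒞 : AutomataCascade.CascadeClass) (M : ℕ), 1 ≤ M →
      𝒞.maxDimΦ ≠ ⊤ → 𝒞.maxDimΘ ≠ ⊤ → 2 ≤ 𝒞.weight →
      ∀ [MeasurableSpace (AutomataCascade.Str 𝒞.S M)]
        (L : 𝒞.B 𝒞.last → 𝒞.B 𝒞.last → Fin 2),
      AutomataCascade.Permissible (𝒞.functions M) →
      ∃ n : ℕ, AutomataCascade.sampleComplexity (𝒞.functions M) L ε η = n ∧
        (n : ℝ) ≤ K * (𝒞.d * 𝒞.weight *
          Real.logb 2 (𝒞.d * 𝒞.weight * M * 𝒞.maxN * 𝒞.maxB))) := by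
  exact ⟨fun 𝒞 M _ ℓ => AutomataCascade.CascadeClass.growth_functions_le M ℓ,
    fun 𝒞 M hM hΦ hΘ hw => 𝒞.exists_dimension_functions_eq hM hΦ hΘ hw,
    AutomataCascade.exists_sampleComplexity_bound⟩
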